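/- **Setting.** Fix a constant $c\in(0,1]$. For $t\ge 0$ there are $n=2t+1+\lceil ct\rceil$ processes $P_1,\dots,P_n$, of which a set of $f\le t$ processes is faulty (Byzantine); let $t_o=\lfloor ct\rfloor$. Computation proceeds in synchronous rounds over authenticated reliable links: a message sent at the beginning of a round is received, with its true sender, by the end of the round. Faulty processes may send any messages (even depending on the messages of the current round), but cannot forge signatures: a partial signature of a correct process occurs in a message of a faulty process only if the correct process has itself already sent it. Values form a totally ordered set with least element $v_{\min}$ and greatest element $v_{\max}$. A $(t+1)$-threshold signature on $m$ is obtained by combining partial signatures on $m$ of at least $t+1$ processes; incorrectly signed messages are ignored. A message costs one word plus one word for each value and each signature in it. The word complexity with $f$ faults is the supremum, over all executions with exactly $f$ faulty processes, of the total number of words sent by correct processes. **Certificates.** A certificate is valid for $v$ if it is a $(t+1)$-threshold signature on $v$, or one on the string "any value", or a list of $k$ groups $(x_i,y_i,\sigma_i)$ with $1\le k\le 5$, $x_i<y_i$, $x_1=v_{\min}$, $y_{i-1}=x_i$, $y_k=v_{\max}$, where $\sigma_i$ is a $(t+1)$-threshold signature on $(x_i,y_i)$. **BUCKET.** It has $t_o+1$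 iterations of six rounds; the $j$-th has leader $L=P_j$. Each process keeps its latest acquired pair (value, valid certificate), if any. (1) A process without a certificate sends AID_REQ to $L$; if it is $L$, it sends it to all processes. (2) A process that received AID_REQ from $L$ *participates* in this iteration and sends $L$ its proposal with a partial signature on it (DISCLOSE). If $L$ received no AID_REQ from itself, it replies with its pair (AID_REPLY) to every process from which it received AID_REQ. (3) If $L$ participates and some value was disclosed by at least $t+1$ processes, $L$ combines the signatures and broadcasts the value with this certificate; otherwise, if at least $n-t_o$ processes disclosed, $L$ broadcasts a list of consecutive groups $[x,y)$ from $v_{\min}$ to $v_{\max}$ such that the disclosed values of at most $t$ processes fall into each group and those of at least $t+1$ processes fall into any two adjacent groups. A non-participating process that received a valid pair in an AID_REPLY from $L$ acquires it. (4) A participant that received from $L$ a list of at most $5$ groups sends $L$ a partial signature on every group that does not contain its proposal. (5) If $L$ participates, has formed groups, has broadcast no certificate in this iteration, and received partial signatures from at least $t+1$ processes for every group, it combines them and broadcasts the resulting certificate for a fixed default value. (6) A participant that received from $L$ a valid pair in such a certificate broadcast acquires it; otherwise it keeps what it had. **STRONG.** All processes first run BUCKET with their proposals. Then, in four rounds: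 (1) a process without a certificate broadcasts HELP_REQ; (2) every process answers each sender of HELP_REQ with a HELP_REPLY that contains its acquired pair (if any) and a partial signature on its own proposal; (3) a process without a certificate acquires a valid pair from a HELP_REPLY, if there is one; otherwise, if for some $v$ it received partial signatures on $v$ from at least $t+1$ processes, it combines them, acquires the resulting pair and broadcasts it (FINAL_CERTIFICATE); otherwise it broadcasts a partial signature on "any value" (ALLOW-ANY); (4) a process still without a certificate acquires a valid pair from a FINAL_CERTIFICATE message, if there is one; otherwise it takes its own proposal together with the combination of the received ALLOW-ANY signatures. Then all processes propose their pairs to an EBA protocol (Byzantine agreement with external validity, whose own signatures use separate keys) and decide the value decided there. In the *relaying* variant a process that acquires a pair from a HELP_REPLY in round (3) also broadcasts it as FINAL_CERTIFICATE. **Theorem.** For every $c\in(0,1]$ and every $K\in\mathbb N$ there is a constant $C$ such that the following holds for all $t\ge0$, all sets of values and all default values. Let EBA be any protocol for $n$ processes in which correct processes send at most $K\,n\,(f+1)$ words in every execution with $f\le t$ faults where all correct processes propose valid pairs. For STRONG without relaying, assume moreover that in EBA correct processes send at most $K\,n^2$ words in every execution with $f\le t$ faults, whatever is proposed (this is not needed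 for the relaying variant). Then, for every $f\le t$, the word complexity of STRONG with $f$ faults is at most $C\,n\,(f+1)$; that is, STRONG achieves $O(n\cdot f)$ word complexity (with $f$ read as $f+1$, so that $f=0$ is covered). -/

import Mathlib

namespace SBA

universe u

/-! ## Signatures

Signatures are ideal. A partial signature records its signer and the signed content; a threshold
signature records the content and the set of processes whose partial signatures were combined.
Unforgeability is a condition on executions (see `Execution.unforgeable`). -/

/-- A partial signature on `content`, produced with the private key of `signer`. -/
structure PSig (n : ℕ) (C : Type u) where
  signer : Fin n
  content : C

/-- A threshold signature on `content`, combined from the partial signatures of `signers`. -/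
structure TSig (n : ℕ) (C : Type u) where
  content : C
  signers : Finset (Fin n)

/-- `ShareSign_i(m)`. -/
def shareSign {n : ℕ} {C : Type u} (i : Fin n) (m : C) : PSig n C := ⟨i, m⟩

/-- `ShareVerify_i(m, s)`. -/
def ShareVerify {n : ℕ} {C : Type u} (i : Fin n) (m : C) (s : PSig n C) : Prop :=
  s = shareSign i m

/-- `Combine` applied to the partial signatures of `m` by the processes in `S`. -/
def combine {n : ℕ} {C : Type u} (m : C) (S : Finset (Fin n)) : TSig n C := ⟨m, S⟩

/-- `CombinedVerify^k(m, s)`. -/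
def CombinedVerify {n : ℕ} {C : Type u} (k : ℕ) (m : C) (s : TSig n C) : Prop :=
  s.content = m ∧ k ≤ s.signers.card

/-- The partial signatures contained in a threshold signature. -/
def TSig.shares {n : ℕ} {C : Type u} (s : TSig n C) : Set (PSig n C) :=
  {p | p.content = s.content ∧ p.signer ∈ s.signers}

/-! ## Synchronous round-based protocols and their executions -/

/-- A synchronous protocol for `n` processes. In each round every process sends, to every process,
a list of messages that depends on its state, and then updates its state from the messages received
in this round. `words m` is the number of words of `m`, and `shares m` is the set of the partial
signatures that `m` contains (directly, or inside a threshold signature). -/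
structure Protocol (n : ℕ) (In Out : Type u) where
  State : Type u
  Msg : Type u
  Content : Type u
  start : Fin n → In → State
  send : Fin n → State → Fin n → List Msg
  recv : Fin n → State → (Fin n → List Msg) → State
  output : Fin n → State → Option Out
  words : Msg → ℕ
  one_le_words : ∀ m, 1 ≤ words m
  shares : Msg → Set (PSig n Content)

/-- An execution in which `B` is the set of faulty (Byzantine) processes.  `sent r i j` is the list
of the messages that `i` sends to `j` in round `r`; they are received by the end of round `r`.
Correct processes follow the protocol. Faulty processes send arbitrary messages, possibly depending
on everything sent up to and including the current round, except that they cannot forge signatures: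
a partial signature of a correct process occurs in their messages only if that process has itself
sent it by then. -/
structure Execution {n : ℕ} {In Out : Type u} (P : Protocol n In Out) (B : Finset (Fin n)) where
  input : Fin n → In
  state : ℕ → Fin n → P.State
  sent : ℕ → Fin n → Fin n → List P.Msg
  state_zero : ∀ i, i ∉ B → state 0 i = P.start i (input i)
  sent_correct : ∀ r i, i ∉ B → ∀ j, sent r i j = P.send i (state r i) j
  state_succ : ∀ r i, i ∉ B → state (r + 1) i = P.recv i (state r i) (fun j => sent r j i)
  unforgeable : ∀ r i, i ∈ B → ∀ j, ∀ m ∈ sent r i j, ∀ s ∈ P.shares m, s.signer ∉ B →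
    ∃ r' ≤ r, ∃ j', ∃ m' ∈ sent r' s.signer j', s ∈ P.shares m'

/-- The number of words sent by correct processes in rounds `0, …, R - 1`. -/
def Execution.wordsBefore {n : ℕ} {In Out : Type u} {P : Protocol n In Out} {B : Finset (Fin n)}
    (α : Execution P B) (R : ℕ) : ℕ :=
  ∑ r ∈ Finset.range R, ∑ i ∈ Bᶜ, ∑ j, ((α.sent r i j).map P.words).sum

/-- The number of words sent by correct processes in the whole execution (`⊤` if infinite). -/
noncomputable def Execution.wordComplexity {n : ℕ} {In Out : Type u} {P : Protocol n In Out}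
    {B : Finset (Fin n)} (α : Execution P B) : ℕ∞ :=
  ⨆ R : ℕ, (α.wordsBefore R : ℕ∞)

/-- The word complexity of a protocol with `f` actual faults: the supremum of the word complexity
over all executions with exactly `f` faulty processes in which the input of every correct process
satisfies `Legal`. -/
noncomputable def Protocol.wordComplexity {n : ℕ} {In Out : Type u} (P : Protocol n In Out)
    (Legal : In → Prop) (f : ℕ) : ℕ∞ :=
  ⨆ (B : Finset (Fin n)) (_ : B.card = f) (α : Execution P B)
    (_ : ∀ i, i ∉ B → Legal (α.input i)), α.wordComplexity

/-! ## Certificates -/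

/-- What processes sign in BUCKET and in STRONG: a value, the string "any value", or a group. -/
inductive Content (V : Type u) where
  | value (v : V)
  | anyValue
  | group (x y : V)

/-- A certificate is a single threshold signature (on a value: a positive bucket certificate or a
specific certificate; on "any value": a general certificate), or a list of signed groups
`(x, y, σ)` (a negative bucket certificate). -/
inductive Certificate (n : ℕ) (V : Type u) where
  | single (s : TSig n (Content V))
  | negative (gs : List (V × V × TSig n (Content V)))

/-- The maximal number of groups that is accepted in a partition and in a certificate. -/
def maxGroups : ℕ := 5

/-- `gs = [(x₁, y₁), …, (x_k, y_k)]` is a chain of groups from the least to the greatest value: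
`k > 0`, `x_i < y_i`, `y_{i-1} = x_i`, `x₁ = v_min` and `y_k = v_max`. -/
def IsGroupChain {V : Type u} [LinearOrder V] [BoundedOrder V] (gs : List (V × V)) : Prop :=
  (∀ g ∈ gs, g.1 < g.2) ∧
  gs.IsChain (fun g g' => g.2 = g'.1) ∧
  gs.head?.map Prod.fst = some ⊥ ∧
  gs.getLast?.map Prod.snd = some ⊤

/-- `validate(v, Σ) = true`. -/
def Valid {n : ℕ} {V : Type u} [LinearOrder V] [BoundedOrder V] (t : ℕ) :
    V × Certificate n V → Prop
  | (v, .single s) =>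
      CombinedVerify (t + 1) (.value v) s ∨ CombinedVerify (t + 1) .anyValue s
  | (_, .negative gs) =>
      gs.length ≤ maxGroups ∧
      IsGroupChain (gs.map fun g => (g.1, g.2.1)) ∧
      ∀ g ∈ gs, CombinedVerify (t + 1) (.group g.1 g.2.1) g.2.2

/-- The number of values and signatures in a certificate. -/
def Certificate.words {n : ℕ} {V : Type u} : Certificate n V → ℕ
  | .single _ => 1
  | .negative gs => 3 * gs.length

/-- The partial signatures contained in a certificate. -/
def Certificate.shares {n : ℕ} {V : Type u} : Certificate n V → Set (PSig n (Content V))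
  | .single s => s.shares
  | .negative gs => {p | ∃ g ∈ gs, p ∈ g.2.2.shares}

/-! ## Messages of BUCKET and STRONG -/

inductive Msg (n : ℕ) (V : Type u) where
  | aidReq
  | aidReply (c : Option (V × Certificate n V))
  | disclose (v : V) (sig : PSig n (Content V))
  | partitionReq (groups : List (V × V))
  | partitionReply (negatives : List ((V × V) × PSig n (Content V)))
  | certificate (c : V × Certificate n V)
  | helpReq
  | helpReply (c : Option (V × Certificate n V)) (sig : PSig n (Content V))
  | finalCertificate (c : V × Certificate n V)
  | allowAny (sig : PSig n (Content V))

/-- Words of an optional value-certificate pair. -/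
def pairWords {n : ℕ} {V : Type u} : Option (V × Certificate n V) → ℕ
  | none => 0
  | some c => 1 + c.2.words

/-- Partial signatures in an optional value-certificate pair. -/
def pairShares {n : ℕ} {V : Type u} : Option (V × Certificate n V) → Set (PSig n (Content V))
  | none => ∅
  | some c => c.2.shares

/-- One word for the kind of the message and one for each value and each signature in it. -/
def Msg.words {n : ℕ} {V : Type u} : Msg n V → ℕ
  | .aidReq => 1
  | .aidReply c => 1 + pairWords c
  | .disclose _ _ => 1 + 2
  | .partitionReq gs => 1 + 2 * gs.length
  | .partitionReply ns => 1 + 3 * ns.length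
  | .certificate c => 1 + pairWords (some c)
  | .helpReq => 1
  | .helpReply c _ => 1 + (pairWords c + 1)
  | .finalCertificate c => 1 + pairWords (some c)
  | .allowAny _ => 1 + 1

theorem Msg.one_le_words {n : ℕ} {V : Type u} (m : Msg n V) : 1 ≤ m.words := by
  cases m <;> simp [Msg.words]

/-- The partial signatures contained in a message. -/
def Msg.shares {n : ℕ} {V : Type u} : Msg n V → Set (PSig n (Content V))
  | .aidReq => ∅
  | .aidReply c => pairShares c
  | .disclose _ s => {s}
  | .partitionReq _ => ∅
  | .partitionReply ns => {p | ∃ g ∈ ns, p = g.2}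
  | .certificate c => c.2.shares
  | .helpReq => ∅
  | .helpReply c s => pairShares c ∪ {s}
  | .finalCertificate c => c.2.shares
  | .allowAny s => {s}

/-! The following functions read the content of a message of a given kind. -/

def Msg.aidReply? {n : ℕ} {V : Type u} : Msg n V → Option (V × Certificate n V)
  | .aidReply c => c
  | _ => none

def Msg.certificate? {n : ℕ} {V : Type u} : Msg n V → Option (V × Certificate n V)
  | .certificate c => some c
  | _ => none

def Msg.helpReply? {n : ℕ} {V : Type u} : Msg n V → Option (V × Certificate n V)
  | .helpReply c _ => c
  | _ => none

def Msg.finalCertificate? {n : ℕ} {V : Type u} : Msg n V → Option (V × Certificate n V)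
  | .finalCertificate c => some c
  | _ => none

def Msg.partitionReq? {n : ℕ} {V : Type u} : Msg n V → Option (List (V × V))
  | .partitionReq gs => some gs
  | _ => none

open scoped Classical in
/-- The disclosed value, if the message is a DISCLOSE message correctly signed by its sender `j`. -/
noncomputable def Msg.disclosed? {n : ℕ} {V : Type u} (j : Fin n) : Msg n V → Option V
  | .disclose v s => if ShareVerify j (.value v) s then some v else none
  | _ => none

open scoped Classical in
/-- The first valid value-certificate pair in a list. -/
noncomputable def firstValid {n : ℕ} {V : Type u} [LinearOrder V] [BoundedOrder V] (t : ℕ)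
    (l : List (V × Certificate n V)) : Option (V × Certificate n V) :=
  l.find? (fun c => decide (Valid t c))

/-- All received messages, from all senders. -/
def allMsgs {n : ℕ} {V : Type u} (inbox : Fin n → List (Msg n V)) : List (Msg n V) :=
  (List.finRange n).flatMap inbox

/-! ## Local state -/

/-- Parameters: the maximal number `t` of faults, the optimistic threshold `tO`, the default value,
and whether a process which in round 3 of the agreement phase acquires a certificate from a
HELP_REPLY message broadcasts it in a FINAL_CERTIFICATE message. -/
structure Config (V : Type u) where
  t : ℕ
  tO : ℕ
  defaultValue : V
  relay : Bool

/-- Local variables of a process outside of EBA. `cert` is the acquired value-certificate pair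
(`none` if `certificate_acquired` is false); `started`, `groups`, `announced` belong to the current
iteration of BUCKET: whether the process has invoked `certificate_creation`, the groups that it has
formed as the leader, and whether it has broadcast a certificate as the leader. `inbox j` holds the
messages received from `j` in the current iteration of BUCKET, resp. in the agreement phase. -/
structure LocalState (n : ℕ) (V : Type u) where
  round : ℕ
  proposal : V
  cert : Option (V × Certificate n V)
  started : Bool
  groups : Option (List (V × V))
  announced : Bool
  inbox : Fin n → List (Msg n V)

/-- The effect of the code of one round: the new variables and the messages sent. -/
abbrev Action (n : ℕ) (V : Type u) := LocalState n V × (Fin n → List (Msg n V))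

def silent {n : ℕ} {V : Type u} : Fin n → List (Msg n V) := fun _ => []

def broadcast {n : ℕ} {V : Type u} (m : Msg n V) : Fin n → List (Msg n V) := fun _ => [m]

def sendTo {n : ℕ} {V : Type u} (L : Fin n) (m : Msg n V) : Fin n → List (Msg n V) :=
  fun j => if j = L then [m] else []

/-! ## BUCKET -/

/-- The value disclosed by each process, if any. -/
noncomputable def disclosures {n : ℕ} {V : Type u} (inbox : Fin n → List (Msg n V)) :
    Fin n → Option V :=
  fun j => (inbox j).findSome? (Msg.disclosed? j)

open scoped Classical in
/-- The processes that have disclosed the value `v`. -/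
noncomputable def disclosers {n : ℕ} {V : Type u} (D : Fin n → Option V) (v : V) :
    Finset (Fin n) :=
  Finset.univ.filter fun j => D j = some v

/-- The number of processes whose disclosed value falls into `g = (x, y)`, i.e. `x ≤ value < y`. -/
noncomputable def groupCount {n : ℕ} {V : Type u} [LinearOrder V] (D : Fin n → Option V)
    (g : V × V) : ℕ :=
  Set.ncard {j : Fin n | ∃ v, D j = some v ∧ g.1 ≤ v ∧ v < g.2}

/-- Requirements on a partition of the disclosed values: the values of at most `t` processes fall
into each group, and those of at least `t + 1` processes into any two adjacent groups. -/
def IsPartition {n : ℕ} {V : Type u} [LinearOrder V] [BoundedOrder V] (t : ℕ)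
    (D : Fin n → Option V) (gs : List (V × V)) : Prop :=
  IsGroupChain gs ∧
  (∀ g ∈ gs, groupCount D g ≤ t) ∧
  gs.IsChain (fun g g' => t + 1 ≤ groupCount D g + groupCount D g')

open scoped Classical in
/-- `partition(discloses)`. -/
noncomputable def partition {n : ℕ} {V : Type u} [LinearOrder V] [BoundedOrder V] (t : ℕ)
    (D : Fin n → Option V) : List (V × V) :=
  if h : ∃ gs, IsPartition t D gs then h.choose else []

open scoped Classical in
/-- The processes from which a correctly signed partial signature of the group `g` is received. -/
noncomputable def groupSigners {n : ℕ} {V : Type u} (inbox : Fin n → List (Msg n V))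
    (g : V × V) : Finset (Fin n) :=
  Finset.univ.filter fun j => ∃ ns s, Msg.partitionReply ns ∈ inbox j ∧ (g, s) ∈ ns ∧
    ShareVerify j (.group g.1 g.2) s

open scoped Classical in
/-- `construct_negative_certificate(replies, groups)`. -/
noncomputable def constructNegative {n : ℕ} {V : Type u} (t : ℕ) (inbox : Fin n → List (Msg n V)) :
    Option (List (V × V)) → Option (Certificate n V)
  | none => none
  | some gs =>
      if ∀ g ∈ gs, t + 1 ≤ (groupSigners inbox g).card then
        some (.negative (gs.map fun g =>
          (g.1, g.2, combine (.group g.1 g.2) (groupSigners inbox g))))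
      else none

open scoped Classical in
/-- Code of process `i` in round `k + 1` (`0 ≤ k ≤ 5`) of the iteration of BUCKET with leader `L`.
Rounds 1, …, 5 of `certificate_creation` are rounds 2, …, 6 of the iteration. -/
noncomputable def bucketRound {n : ℕ} {V : Type u} [LinearOrder V] [BoundedOrder V]
    (cfg : Config V) (L i : Fin n) (k : ℕ) (s : LocalState n V) : Action n V :=
  match k with
  | 0 =>
    if s.cert = none then
      (s, if i = L then broadcast .aidReq else sendTo L .aidReq)
    else (s, silent)
  | 1 =>
    if Msg.aidReq ∈ s.inbox L then
      ({ s with started := true, groups := none, announced := false },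
        sendTo L (.disclose s.proposal (shareSign i (.value s.proposal))))
    else
      ({ s with started := false, groups := none, announced := false },
        if i = L then fun j => if Msg.aidReq ∈ s.inbox j then [.aidReply s.cert] else []
        else silent)
  | 2 =>
    if s.started then
      if i = L then
        let D := disclosures s.inbox
        if h : ∃ v, cfg.t + 1 ≤ (disclosers D v).card then
          ({ s with announced := true },
            broadcast (.certificate
              (h.choose, .single (combine (.value h.choose) (disclosers D h.choose)))))
        else if n - cfg.tO ≤ (Finset.univ.filter fun j => D j ≠ none).card then
          ({ s with groups := some (partition cfg.t D) },
            broadcast (.partitionReq (partition cfg.t D)))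
        else (s, silent)
      else (s, silent)
    else
      match firstValid cfg.t ((s.inbox L).filterMap Msg.aidReply?) with
      | some c => ({ s with cert := some c }, silent)
      | none => (s, silent)
  | 3 =>
    if s.started then
      match ((s.inbox L).filterMap Msg.partitionReq?).find?
          (fun gs => decide (gs.length ≤ maxGroups)) with
      | some gs =>
        (s, sendTo L (.partitionReply
          ((gs.filter fun g => decide (¬ (g.1 ≤ s.proposal ∧ s.proposal < g.2))).map
            fun g => (g, shareSign i (.group g.1 g.2)))))
      | none => (s, silent)
    else (s, silent)
  | 4 =>
    if s.started ∧ i = L ∧ ¬ s.announced then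
      match constructNegative cfg.t s.inbox s.groups with
      | some S => ({ s with announced := true }, broadcast (.certificate (cfg.defaultValue, S)))
      | none => (s, silent)
    else (s, silent)
  | _ =>
    if s.started then
      match firstValid cfg.t ((s.inbox L).filterMap Msg.certificate?) with
      | some c => ({ s with cert := some c }, silent)
      | none => (s, silent)
    else (s, silent)

/-! ## STRONG -/

open scoped Classical in
/-- The processes from which a HELP_REPLY message with a correct partial signature of the value `v`
is received. -/
noncomputable def helpSigners {n : ℕ} {V : Type u} (inbox : Fin n → List (Msg n V)) (v : V) :
    Finset (Fin n) :=
  Finset.univ.filter fun j => ∃ c s, Msg.helpReply c s ∈ inbox j ∧ ShareVerify j (.value v) s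

open scoped Classical in
/-- The processes from which an ALLOW-ANY message with a correct partial signature is received. -/
noncomputable def allowAnySigners {n : ℕ} {V : Type u} (inbox : Fin n → List (Msg n V)) :
    Finset (Fin n) :=
  Finset.univ.filter fun j => ∃ s, Msg.allowAny s ∈ inbox j ∧ ShareVerify j .anyValue s

open scoped Classical in
/-- Code of process `i` in round `k + 1` (`0 ≤ k ≤ 3`) of the agreement phase. After round 4 the
pair `cert` is proposed to EBA. -/
noncomputable def agreementRound {n : ℕ} {V : Type u} [LinearOrder V] [BoundedOrder V]
    (cfg : Config V) (i : Fin n) (k : ℕ) (s : LocalState n V) : Action n V :=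
  match k with
  | 0 => (s, if s.cert = none then broadcast .helpReq else silent)
  | 1 =>
    (s, fun j => if Msg.helpReq ∈ s.inbox j then
      [.helpReply s.cert (shareSign i (.value s.proposal))] else [])
  | 2 =>
    if s.cert = none then
      match firstValid cfg.t ((allMsgs s.inbox).filterMap Msg.helpReply?) with
      | some c =>
        ({ s with cert := some c }, if cfg.relay then broadcast (.finalCertificate c) else silent)
      | none =>
        if h : ∃ v, cfg.t + 1 ≤ (helpSigners s.inbox v).card then
          let c : V × Certificate n V :=
            (h.choose, .single (combine (.value h.choose) (helpSigners s.inbox h.choose)))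
          ({ s with cert := some c }, broadcast (.finalCertificate c))
        else (s, broadcast (.allowAny (shareSign i .anyValue)))
    else (s, silent)
  | 3 =>
    if s.cert = none then
      match firstValid cfg.t ((allMsgs s.inbox).filterMap Msg.finalCertificate?) with
      | some c => ({ s with cert := some c }, silent)
      | none =>
        let c : V × Certificate n V :=
          (s.proposal, .single (combine .anyValue (allowAnySigners s.inbox)))
        ({ s with cert := some c }, silent)
    else (s, silent)
  | _ => (s, silent)

/-- The number of rounds of BUCKET: `tO + 1` iterations of 6 rounds. -/
def bucketLength {V : Type u} (cfg : Config V) : ℕ := 6 * (cfg.tO + 1)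

/-- The first round of EBA. -/
def ebaStart {V : Type u} (cfg : Config V) : ℕ := bucketLength cfg + 4

/-- Code of process `i` in its current round before EBA. In the `j`-th iteration of BUCKET (counted
from 0) the leader is the `j`-th process. -/
noncomputable def localRound {n : ℕ} {V : Type u} [LinearOrder V] [BoundedOrder V]
    (cfg : Config V) (i : Fin n) (s : LocalState n V) : Action n V :=
  if s.round < bucketLength cfg then
    if h : s.round / 6 < n then bucketRound cfg ⟨s.round / 6, h⟩ i (s.round % 6) s
    else (s, silent)
  else agreementRound cfg i (s.round - bucketLength cfg) s

/-- A protocol that can be used for EBA: inputs (proposals) and outputs (decisions) are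
value-certificate pairs. -/
abbrev EBAProtocol (n : ℕ) (V : Type u) :=
  Protocol n (V × Certificate n V) (V × Certificate n V)

/-- STRONG, with `E` as its EBA protocol: BUCKET, then the four rounds of the agreement phase, then
`E` with the acquired pairs as proposals. A new iteration of BUCKET, as well as the agreement phase,
starts with an empty inbox. -/
noncomputable def strong {n : ℕ} {V : Type u} [LinearOrder V] [BoundedOrder V] (cfg : Config V)
    (E : EBAProtocol n V) : Protocol n V V where
  State := LocalState n V × Option E.State
  Msg := Msg n V ⊕ E.Msg
  Content := Content V ⊕ E.Content
  start _ v :=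
    ({ round := 0, proposal := v, cert := none, started := false, groups := none,
       announced := false, inbox := fun _ => [] }, none)
  send i s j :=
    if s.1.round < ebaStart cfg then ((localRound cfg i s.1).2 j).map Sum.inl
    else (s.2.elim [] fun e => E.send i e j).map Sum.inr
  recv i s inb :=
    let s' := (localRound cfg i s.1).1
    ({ s' with
        round := s.1.round + 1,
        inbox := fun j => if (s.1.round + 1) % 6 = 0 then []
          else s.1.inbox j ++ (inb j).filterMap Sum.getLeft? },
      if s.1.round + 1 < ebaStart cfg then none
      else if s.1.round + 1 = ebaStart cfg then s'.cert.map (E.start i)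
      else s.2.map fun e => E.recv i e fun j => (inb j).filterMap Sum.getRight?)
  output i s := (s.2.bind (E.output i)).map Prod.fst
  words := Sum.elim Msg.words E.words
  one_le_words m := by
    cases m with
    | inl m => exact m.one_le_words
    | inr m => exact E.one_le_words m
  shares m := match m with
    | .inl m => Set.image (fun s => ⟨s.signer, .inl s.content⟩) m.shares
    | .inr m => Set.image (fun s => ⟨s.signer, .inr s.content⟩) (E.shares m)

/-- The number `n = 2t + 1 + ⌈c t⌉` of processes. -/
noncomputable def numProcs (c : ℝ) (t : ℕ) : ℕ := 2 * t + 1 + ⌈c * t⌉₊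

/-- The optimistic threshold `t_o = ⌊c t⌋`. -/
noncomputable def optThreshold (c : ℝ) (t : ℕ) : ℕ := ⌊c * t⌋₊

end SBA

/-!
In an iteration of BUCKET with a correct leader that starts when all correct processes have a
certificate, the only messages are the answers of the leader to faulty processes. Every other
iteration costs `O(n)` words, and there are at most `f + 1` of them: if `f > t_o`, because BUCKET
has only `t_o + 1` iterations, and if `f ≤ t_o`, because the first correct leader provides all
correct processes with certificates. Indeed, it forms at most five groups, as any two adjacent
groups hold at least `t + 1` disclosed values and six groups would need `3 (t + 1) > n` of them; and
as a group holds at most `t` disclosed values, at least `n - t - f ≥ t + 1` correct processes sign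
it.

After BUCKET, if `f ≤ t_o`, the only messages before EBA are answers to faulty processes, and EBA
starts from valid pairs. If `f > t_o = ⌊c t⌋`, then `t < f / c`, so `n = O(f + 1)` and quadratically
many words are affordable, in EBA too. With relaying EBA always starts from valid pairs: if a
correct process receives no valid certificate by the end of round (3), then every correct process
has sent ALLOW-ANY.
-/

namespace SBA

universe u

section Partition

theorem half_length_mul_le_sum {m : ℕ} :
    ∀ l : List ℕ, l.IsChain (fun a b => m ≤ a + b) → l.length / 2 * m ≤ l.sum
  | [], _ | [_], _ => by simp
  | a :: b :: l, h => by
    obtain ⟨hab, hbl⟩ := List.isChain_cons_cons.1 h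
    have ih := half_length_mul_le_sum l hbl.tail
    calc (l.length + 2) / 2 * m = m + l.length / 2 * m := by
          rw [Nat.add_div_right _ two_pos, Nat.succ_mul, Nat.add_comm]
      _ ≤ (a + b) + l.sum := add_le_add hab ih
      _ = (a :: b :: l).sum := by simp only [List.sum_cons, Nat.add_assoc]

variable {n t : ℕ} {V : Type u} [LinearOrder V] {D : Fin n → Option V} {x y v : V}

theorem groupCount_le (D : Fin n → Option V) (g : V × V) : groupCount D g ≤ n := by
  simpa [groupCount] using
    Set.ncard_le_card (s := {j : Fin n | ∃ v, D j = some v ∧ g.1 ≤ v ∧ v < g.2})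

theorem groupCount_add (D : Fin n → Option V) (hxv : x ≤ v) (hvy : v ≤ y) :
    groupCount D (x, v) + groupCount D (v, y) = groupCount D (x, y) := by
  unfold groupCount
  rw [← Set.ncard_union_eq _ (Set.toFinite _) (Set.toFinite _)]
  · congr 1
    ext j
    simp only [Set.mem_union, Set.mem_ofPred_eq]
    constructor
    · rintro (⟨w, hj, hxw, hwv⟩ | ⟨w, hj, hvw, hwy⟩)
      · exact ⟨w, hj, hxw, hwv.trans_le hvy⟩
      · exact ⟨w, hj, hxv.trans hvw, hwy⟩
    · rintro ⟨w, hj, hxw, hwy⟩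
      rcases lt_or_ge w v with hwv | hvw
      · exact .inl ⟨w, hj, hxw, hwv⟩
      · exact .inr ⟨w, hj, hvw, hwy⟩
  · rw [Set.disjoint_left]
    rintro j ⟨w, hj, _, hwv⟩ ⟨w', hj', hvw', _⟩
    obtain rfl : w = w' := Option.some_injective _ (hj.symm.trans hj')
    exact hwv.not_ge hvw'

theorem exists_sum_groupCount_eq (D : Fin n → Option V) :
    ∀ (g : V × V) (gs : List (V × V)), (∀ g' ∈ g :: gs, g'.1 < g'.2) →
      (g :: gs).IsChain (fun g g' => g.2 = g'.1) →
      ∃ y, g.1 < y ∧ ((g :: gs).map (groupCount D)).sum = groupCount D (g.1, y)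
  | g, [], hlt, _ => ⟨g.2, hlt g List.mem_cons_self, by simp⟩
  | g, g' :: gs, hlt, hchain => by
    obtain ⟨hgg', hchain⟩ := List.isChain_cons_cons.1 hchain
    obtain ⟨y, hy, hsum⟩ := exists_sum_groupCount_eq D g' gs
      (fun _ h => hlt _ (List.mem_cons_of_mem _ h)) hchain
    have hg : g.1 < g'.1 := hgg' ▸ hlt g List.mem_cons_self
    refine ⟨y, hg.trans hy, ?_⟩
    rw [List.map_cons, List.sum_cons, hsum, ← groupCount_add D hg.le hy.le, ← hgg']

/-- The number of processes whose disclosed value lies in the closed interval `[x, v]`; unlike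
`groupCount D (x, v)` it includes the processes that disclose `v`. -/
noncomputable def closedGroupCount (D : Fin n → Option V) (x v : V) : ℕ :=
  Set.ncard {j : Fin n | ∃ w, D j = some w ∧ x ≤ w ∧ w ≤ v}

theorem exists_closedGroupCount_eq (h : 0 < groupCount D (x, y)) :
    ∃ v ∈ Set.Ico x y, some v ∈ Set.range D ∧ closedGroupCount D x v = groupCount D (x, y) := by
  obtain ⟨j, ⟨v, hj, hxv, hvy⟩, hmax⟩ := Set.exists_max_image
    {j : Fin n | ∃ v, D j = some v ∧ x ≤ v ∧ v < y} (fun j => (D j).getD x)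
    (Set.toFinite _) ((Set.ncard_pos (Set.toFinite _)).1 h)
  refine ⟨v, ⟨hxv, hvy⟩, ⟨j, hj⟩, ?_⟩
  unfold closedGroupCount groupCount
  congr 1
  ext k
  constructor
  · rintro ⟨w, hk, hxw, hwv⟩
    exact ⟨w, hk, hxw, hwv.trans_lt hvy⟩
  · rintro ⟨w, hk, hxw, hwy⟩
    have hwv := hmax k ⟨w, hk, hxw, hwy⟩
    rw [hj, hk] at hwv
    exact ⟨w, hk, hxw, hwv⟩

theorem closedGroupCount_le_groupCount_add_groupCount (hvy : v < y) :
    closedGroupCount D x v ≤ groupCount D (x, v) + groupCount D (v, y) := by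
  refine (Set.ncard_le_ncard ?_ (Set.toFinite _)).trans (Set.ncard_union_le _ _)
  rintro j ⟨w, hj, hxw, hwv⟩
  rcases hwv.lt_or_eq with hwv | rfl
  · exact .inl ⟨w, hj, hxw, hwv⟩
  · exact .inr ⟨w, hj, le_rfl, hvy⟩

theorem closedGroupCount_le_groupCount_add_card_disclosers :
    closedGroupCount D x v ≤ groupCount D (x, v) + (disclosers D v).card := by
  rw [← Set.ncard_coe_finset]
  refine (Set.ncard_le_ncard ?_ (Set.toFinite _)).trans (Set.ncard_union_le _ _)
  rintro j ⟨w, hj, hxw, hwv⟩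
  rcases hwv.lt_or_eq with hwv | rfl
  · exact .inl ⟨w, hj, hxw, hwv⟩
  · exact .inr (by simp [disclosers, hj])

/-- The part of a partition of the disclosed values that covers the values from `x` on. Partitions
are built from the greatest value downwards by adding groups in front. -/
structure IsPartitionFrom [OrderTop V] (t : ℕ) (D : Fin n → Option V) (x : V)
    (gs : List (V × V)) : Prop where
  lt : ∀ g ∈ gs, g.1 < g.2
  chain : gs.IsChain fun g g' => g.2 = g'.1
  head : gs.head?.map Prod.fst = some x
  last : gs.getLast?.map Prod.snd = some ⊤
  count_le : ∀ g ∈ gs, groupCount D g ≤ t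
  adjacent : gs.IsChain fun g g' => t + 1 ≤ groupCount D g + groupCount D g'

theorem IsPartitionFrom.singleton [OrderTop V] (hx : x < ⊤) (hle : groupCount D (x, ⊤) ≤ t) :
    IsPartitionFrom t D x [(x, ⊤)] where
  lt := by simpa using hx
  chain := .singleton _
  head := rfl
  last := rfl
  count_le := by simpa using hle
  adjacent := .singleton _

theorem IsPartitionFrom.cons [OrderTop V] {gs : List (V × V)} (h : IsPartitionFrom t D v gs)
    (hxv : x < v) (hle : groupCount D (x, v) ≤ t) (hlt : t < closedGroupCount D x v) :
    IsPartitionFrom t D x ((x, v) :: gs) := by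
  match gs, h with
  | (_, y) :: gs, ⟨hlts, hchain, hhead, hlast, hcount, hadj⟩ =>
    obtain rfl := Option.some_injective _ hhead
    exact
      { lt := List.forall_mem_cons.2 ⟨hxv, hlts⟩
        chain := hchain.cons_cons rfl
        head := rfl
        last := by rwa [List.getLast?_cons_cons]
        count_le := List.forall_mem_cons.2 ⟨hle, hcount⟩
        adjacent := hadj.cons_cons <| hlt.trans_le <|
          closedGroupCount_le_groupCount_add_groupCount (hlts _ List.mem_cons_self) }

/-- Cut at the least disclosed value up to which more than `t` processes have disclosed values. -/
theorem exists_groupCount_le_lt_closedGroupCount (hD : ∀ v, (disclosers D v).card ≤ t)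
    (h : t < groupCount D (x, y)) :
    ∃ v ∈ Set.Ioo x y, groupCount D (x, v) ∈ Set.Ioc 0 t ∧ t < closedGroupCount D x v := by
  have hfin : {v ∈ Set.Ico x y | some v ∈ Set.range D ∧ t < closedGroupCount D x v}.Finite :=
    ((Set.finite_range D).preimage (Option.some_injective V).injOn).subset fun _ hv => hv.2.1
  obtain ⟨v, ⟨⟨-, hvy⟩, -, hv⟩, hmin⟩ := Set.exists_min_image _ id hfin <| by
    obtain ⟨v, hv, hDv, heq⟩ := exists_closedGroupCount_eq (Nat.zero_lt_of_lt h)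
    exact ⟨v, hv, hDv, heq ▸ h⟩
  have hle : groupCount D (x, v) ≤ t := by
    by_contra! hlt
    obtain ⟨w, ⟨hxw, hwv⟩, hDw, heq⟩ := exists_closedGroupCount_eq (Nat.zero_lt_of_lt hlt)
    exact hwv.not_ge (hmin w ⟨⟨hxw, hwv.trans hvy⟩, hDw, heq ▸ hlt⟩)
  have hpos : 0 < groupCount D (x, v) := by
    have := hv.trans_le closedGroupCount_le_groupCount_add_card_disclosers
    have := hD v
    omega
  obtain ⟨w, ⟨hxw, hwv⟩, -⟩ := exists_closedGroupCount_eq hpos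
  exact ⟨v, ⟨hxw.trans_lt hwv, hvy⟩, ⟨hpos, hle⟩, hv⟩

theorem exists_isPartitionFrom [OrderTop V] (hD : ∀ v, (disclosers D v).card ≤ t) (x : V)
    (hx : x < ⊤) : ∃ gs, IsPartitionFrom t D x gs := by
  induction hN : groupCount D (x, ⊤) using Nat.strong_induction_on generalizing x with
  | _ N ih =>
    subst hN
    rcases le_or_gt (groupCount D (x, ⊤)) t with hle | hlt
    · exact ⟨_, .singleton hx hle⟩
    · obtain ⟨v, ⟨hxv, hv⟩, ⟨hpos, hle⟩, hlt'⟩ := exists_groupCount_le_lt_closedGroupCount hD hlt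
      have := groupCount_add D hxv.le hv.le
      obtain ⟨gs, hgs⟩ := ih _ (by omega) v hv rfl
      exact ⟨_, hgs.cons hxv hle hlt'⟩

variable [BoundedOrder V]

theorem exists_isPartition [Nontrivial V] (hD : ∀ v, (disclosers D v).card ≤ t) :
    ∃ gs, IsPartition t D gs :=
  let ⟨gs, h⟩ := exists_isPartitionFrom hD ⊥ bot_lt_top
  ⟨gs, ⟨h.lt, h.chain, h.head, h.last⟩, h.count_le, h.adjacent⟩

theorem isPartition_partition (h : ∃ gs, IsPartition t D gs) : IsPartition t D (partition t D) := by
  rw [partition, dif_pos h]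
  exact h.choose_spec

/-- Six groups would form three disjoint pairs of adjacent groups, into which the disclosed values
of `3 * (t + 1)` processes would fall. -/
theorem IsPartition.length_le_maxGroups (hn : n < 3 * (t + 1)) {gs : List (V × V)}
    (h : IsPartition t D gs) : gs.length ≤ maxGroups := by
  obtain ⟨⟨hlt, hchain, -, -⟩, -, hadj⟩ := h
  have hpairs := half_length_mul_le_sum (gs.map (groupCount D)) ((List.isChain_map _).2 hadj)
  rw [List.length_map] at hpairs
  have hsum : (gs.map (groupCount D)).sum ≤ n := by
    cases gs with
    | nil => exact Nat.zero_le n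
    | cons g gs =>
      obtain ⟨y, -, heq⟩ := exists_sum_groupCount_eq D g gs hlt hchain
      exact heq ▸ groupCount_le D _
  have : gs.length / 2 < 3 := lt_of_mul_lt_mul_right' (hpairs.trans_lt (hsum.trans_lt hn))
  rw [maxGroups]
  omega

theorem length_partition_le_maxGroups (hn : n < 3 * (t + 1)) (D : Fin n → Option V) :
    (partition t D).length ≤ maxGroups := by
  by_cases h : ∃ gs, IsPartition t D gs
  · exact (isPartition_partition h).length_le_maxGroups hn
  · simp [partition, h]

end Partition

section Certificates

theorem constructNegative_words_le {n t : ℕ} {V : Type u} {inbox : Fin n → List (Msg n V)}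
    {o : Option (List (V × V))} {C : Certificate n V} (h : constructNegative t inbox o = some C)
    (ho : ∀ gs ∈ o, gs.length ≤ maxGroups) : C.words ≤ 3 * maxGroups := by
  revert h
  fun_cases constructNegative with
  | case2 gs =>
    rintro ⟨⟩
    simpa [Certificate.words] using ho gs rfl
  | _ => exact nofun

variable {n t : ℕ} {V : Type u} [LinearOrder V] [BoundedOrder V] {v : V} {S : Finset (Fin n)}
  {c : V × Certificate n V} {l : List (V × Certificate n V)}
  {inbox : Fin n → List (Msg n V)} {gs : List (V × V)}

theorem Valid.words_le (h : Valid t c) : c.2.words ≤ 3 * maxGroups := by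
  obtain ⟨v, s | gs⟩ := c
  · simp [Certificate.words, maxGroups]
  · exact Nat.mul_le_mul_left 3 h.1

theorem valid_combine_value (h : t + 1 ≤ S.card) : Valid t (v, .single (combine (.value v) S)) :=
  .inl ⟨rfl, h⟩

theorem valid_combine_anyValue (h : t + 1 ≤ S.card) :
    Valid t (v, .single (combine .anyValue S)) :=
  .inr ⟨rfl, h⟩

theorem valid_of_firstValid_eq_some (h : firstValid t l = some c) : Valid t c := by
  simpa using List.find?_some h

theorem firstValid_ne_none (hc : c ∈ l) (h : Valid t c) : firstValid t l ≠ none := by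
  intro hnone
  simpa [h] using List.find?_eq_none.1 hnone c hc

theorem exists_constructNegative_eq_some (hlen : gs.length ≤ maxGroups) (hchain : IsGroupChain gs)
    (hsigners : ∀ g ∈ gs, t + 1 ≤ (groupSigners inbox g).card) :
    ∃ C, constructNegative t inbox (some gs) = some C ∧ Valid t (v, C) := by
  refine ⟨.negative _, by rw [constructNegative, if_pos hsigners], ?_, ?_, ?_⟩
  · rwa [List.length_map]
  · simpa only [List.map_map, Function.comp_def, Prod.mk.eta, List.map_id'] using hchain
  · simp only [List.forall_mem_map]
    exact fun g hg => ⟨rfl, hsigners g hg⟩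

end Certificates

/-- The word cost of the longest message of a correct process: a HELP_REPLY message that contains
its kind, a value, a list of `maxGroups` signed groups and a partial signature. -/
def maxMsgWords : ℕ := 3 * maxGroups + 3

section Short

variable {n : ℕ} {V : Type u} {out out' : Fin n → List (Msg n V)} {m : Msg n V} {L : Fin n}

/-- The messages sent to each process in one round cost at most as much as one longest message. -/
def IsShort (out : Fin n → List (Msg n V)) : Prop :=
  ∀ j, ((out j).map Msg.words).sum ≤ maxMsgWords

theorem isShort_silent : IsShort (silent : Fin n → List (Msg n V)) := fun _ => Nat.zero_le _

theorem isShort_broadcast (h : m.words ≤ maxMsgWords) : IsShort (broadcast (n := n) m) :=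
  fun _ => h

theorem isShort_ite_singleton {p : Fin n → Prop} {_ : DecidablePred p} (h : m.words ≤ maxMsgWords) :
    IsShort fun j => if p j then [m] else [] := by
  intro j
  dsimp only
  split
  exacts [h, Nat.zero_le _]

theorem isShort_sendTo (h : m.words ≤ maxMsgWords) : IsShort (sendTo L m) :=
  isShort_ite_singleton h

theorem IsShort.ite {p : Prop} {_ : Decidable p} (h : IsShort out) (h' : IsShort out') :
    IsShort (if p then out else out') := by
  split
  exacts [h, h']

theorem Msg.words_certificate_le {c : V × Certificate n V} (h : c.2.words ≤ 3 * maxGroups) :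
    (Msg.certificate c).words ≤ maxMsgWords := by
  simp only [Msg.words, pairWords, maxMsgWords]
  omega

theorem Msg.words_finalCertificate_le {c : V × Certificate n V} (h : c.2.words ≤ 3 * maxGroups) :
    (Msg.finalCertificate c).words ≤ maxMsgWords := by
  simp only [Msg.words, pairWords, maxMsgWords]
  omega

end Short

section Rounds

variable {n t : ℕ} {V : Type u} [LinearOrder V] [BoundedOrder V] {cfg : Config V} {L i j : Fin n}
  {k : ℕ} {s : LocalState n V} {c : V × Certificate n V}

/-- An invariant of the local variables of correct processes up to the last round of the agreement
phase: the acquired certificate is valid, and the groups formed as the leader are not too many. -/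
structure LocalState.Sound (t : ℕ) (s : LocalState n V) : Prop where
  valid : ∀ c ∈ s.cert, Valid t c
  length_groups_le : ∀ gs ∈ s.groups, gs.length ≤ maxGroups

theorem LocalState.Sound.setCert (hs : s.Sound t) (hc : Valid t c) :
    LocalState.Sound t { s with cert := some c } :=
  ⟨fun _ h => Option.some.inj h ▸ hc, hs.length_groups_le⟩

theorem LocalState.Sound.setGroups (hs : s.Sound t) {gs : List (V × V)}
    (hgs : gs.length ≤ maxGroups) : LocalState.Sound t { s with groups := some gs } :=
  ⟨hs.valid, fun _ h => Option.some.inj h ▸ hgs⟩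

theorem LocalState.Sound.pairWords_le (hs : s.Sound t) :
    pairWords s.cert ≤ 3 * maxGroups + 1 := by
  cases h : s.cert with
  | none => exact Nat.zero_le _
  | some c => simpa [pairWords, Nat.add_comm] using (hs.valid c h).words_le

theorem bucketRound_proposal : (bucketRound cfg L i k s).1.proposal = s.proposal := by
  fun_cases bucketRound <;> rfl

theorem bucketRound_started (hk : k ≠ 1) : (bucketRound cfg L i k s).1.started = s.started := by
  fun_cases bucketRound <;> first | rfl | contradiction

theorem bucketRound_cert_ne_none (h : s.cert ≠ none) :
    (bucketRound cfg L i k s).1.cert ≠ none := by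
  fun_cases bucketRound <;> first | exact h | exact Option.some_ne_none _

theorem agreementRound_cert_ne_none (h : s.cert ≠ none) :
    (agreementRound cfg i k s).1.cert ≠ none := by
  fun_cases agreementRound <;> first | exact h | exact Option.some_ne_none _

theorem LocalState.Sound.bucketRound (hn : n < 3 * (cfg.t + 1)) (hs : s.Sound cfg.t) :
    (bucketRound cfg L i k s).1.Sound cfg.t := by
  fun_cases SBA.bucketRound <;> first
    | exact hs
    | exact hs.setCert (valid_of_firstValid_eq_some ‹_›)
    | exact hs.setGroups (length_partition_le_maxGroups hn _)
    | exact ⟨hs.valid, hs.length_groups_le⟩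
    | exact ⟨hs.valid, by simp⟩

theorem LocalState.Sound.agreementRound (hk : k ≠ 3) (hs : s.Sound cfg.t) :
    (agreementRound cfg i k s).1.Sound cfg.t := by
  fun_cases SBA.agreementRound <;> first
    | exact hs
    | contradiction
    | exact hs.setCert (valid_of_firstValid_eq_some ‹_›)
    | exact hs.setCert (valid_combine_value (Exists.choose_spec ‹_›))

theorem isShort_bucketRound (hn : n < 3 * (cfg.t + 1)) (hs : s.Sound cfg.t) :
    IsShort (bucketRound cfg L i k s).2 := by
  fun_cases bucketRound
  any_goals exact isShort_silent
  · exact .ite (isShort_broadcast (by simp [Msg.words, maxMsgWords]))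
      (isShort_sendTo (by simp [Msg.words, maxMsgWords]))
  · exact isShort_sendTo (by simp [Msg.words, maxMsgWords])
  · refine .ite (isShort_ite_singleton ?_) isShort_silent
    have := hs.pairWords_le
    simp only [Msg.words, maxMsgWords]
    omega
  · exact isShort_broadcast
      (Msg.words_certificate_le (valid_combine_value (Exists.choose_spec ‹_›)).words_le)
  case case6 D _ _ =>
    refine isShort_broadcast ?_
    have := length_partition_le_maxGroups hn D
    simp only [Msg.words, maxMsgWords]
    omega
  case case11 gs hgs =>
    refine isShort_sendTo ?_
    have hlen : gs.length ≤ maxGroups := by simpa using List.find?_some hgs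
    have := (List.length_filter_le (fun g : V × V => decide ¬(g.1 ≤ s.proposal ∧ s.proposal < g.2))
      gs).trans hlen
    simp only [Msg.words, List.length_map, maxMsgWords]
    omega
  · exact isShort_broadcast
      (Msg.words_certificate_le (constructNegative_words_le ‹_› hs.length_groups_le))

theorem isShort_agreementRound (hs : s.Sound cfg.t) : IsShort (agreementRound cfg i k s).2 := by
  fun_cases agreementRound
  any_goals exact isShort_silent
  · exact .ite (isShort_broadcast (by simp [Msg.words, maxMsgWords])) isShort_silent
  · refine isShort_ite_singleton ?_
    have := hs.pairWords_le
    simp only [Msg.words, maxMsgWords]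
    omega
  · exact .ite (isShort_broadcast
      (Msg.words_finalCertificate_le (valid_of_firstValid_eq_some ‹_›).words_le)) isShort_silent
  · exact isShort_broadcast
      (Msg.words_finalCertificate_le (valid_combine_value (Exists.choose_spec ‹_›)).words_le)
  · exact isShort_broadcast (by simp [Msg.words, maxMsgWords])

theorem bucketRound_send_eq_nil (hi : i ≠ L) (hj : j ≠ L) :
    (bucketRound cfg L i k s).2 j = [] := by
  fun_cases bucketRound <;> first | rfl | contradiction | simp_all [silent, sendTo]

end Rounds

section BucketRounds

variable {n : ℕ} {V : Type u} [LinearOrder V] [BoundedOrder V] {cfg : Config V} {L i j : Fin n}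
  {k : ℕ} {s : LocalState n V} {c : V × Certificate n V} {gs : List (V × V)}

theorem bucketRound_zero_state : (bucketRound cfg L i 0 s).1 = s := by
  rw [bucketRound]
  split <;> rfl

theorem bucketRound_zero_send : (bucketRound cfg L i 0 s).2 j =
    if s.cert = none ∧ (i = L ∨ j = L) then [.aidReq] else [] := by
  by_cases hc : s.cert = none <;> by_cases hi : i = L <;>
    simp [bucketRound, hc, hi, broadcast, sendTo, silent]

theorem bucketRound_one_announced : (bucketRound cfg L i 1 s).1.announced = false := by
  rw [bucketRound]
  split <;> rfl

theorem bucketRound_one_started_eq_true_iff :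
    (bucketRound cfg L i 1 s).1.started = true ↔ Msg.aidReq ∈ s.inbox L := by
  rw [bucketRound]
  split <;> simpa

theorem bucketRound_one_send_of_mem (h : Msg.aidReq ∈ s.inbox L) :
    (bucketRound cfg L i 1 s).2 =
      sendTo L (.disclose s.proposal (shareSign i (.value s.proposal))) := by
  rw [bucketRound, if_pos h]

open scoped Classical in
theorem bucketRound_one_send_of_notMem (h : Msg.aidReq ∉ s.inbox L) :
    (bucketRound cfg L i 1 s).2 j =
      if i = L ∧ Msg.aidReq ∈ s.inbox j then [.aidReply s.cert] else [] := by
  rw [bucketRound, if_neg h]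
  by_cases hi : i = L <;> simp [hi, silent]

theorem bucketRound_send_of_not_started (hk : 2 ≤ k) (h : ¬s.started = true) :
    (bucketRound cfg L i k s).2 = silent := by
  fun_cases bucketRound <;> first | rfl | omega | simp_all

theorem bucketRound_two_cert_of_aidReply (h : ¬s.started = true)
    (hc : Msg.aidReply (some c) ∈ s.inbox L) (hv : Valid cfg.t c) :
    (bucketRound cfg L i 2 s).1.cert ≠ none := by
  have hne := firstValid_ne_none (List.mem_filterMap.2 ⟨_, hc, rfl⟩ :
    c ∈ (s.inbox L).filterMap Msg.aidReply?) hv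
  rw [bucketRound, if_neg h]
  split
  · exact Option.some_ne_none _
  · contradiction

theorem bucketRound_five_cert_of_certificate (h : s.started = true)
    (hc : Msg.certificate c ∈ s.inbox L) (hv : Valid cfg.t c) :
    (bucketRound cfg L i 5 s).1.cert ≠ none := by
  have hne := firstValid_ne_none (List.mem_filterMap.2 ⟨_, hc, rfl⟩ :
    c ∈ (s.inbox L).filterMap Msg.certificate?) hv
  simp only [bucketRound, h, if_true]
  split
  · exact Option.some_ne_none _
  · contradiction

theorem exists_bucketRound_two_send_certificate (h : s.started = true)
    (hv : ∃ v, cfg.t + 1 ≤ (disclosers (disclosures s.inbox) v).card) :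
    ∃ c, Valid cfg.t c ∧ (bucketRound cfg L L 2 s).2 = broadcast (.certificate c) := by
  refine ⟨(hv.choose, _), valid_combine_value hv.choose_spec, ?_⟩
  simp only [bucketRound, h, if_true, dif_pos hv]

open scoped Classical in
theorem bucketRound_two_of_no_popular_value (h : s.started = true)
    (hv : ¬∃ v, cfg.t + 1 ≤ (disclosers (disclosures s.inbox) v).card)
    (hd : n - cfg.tO ≤ (Finset.univ.filter fun j => disclosures s.inbox j ≠ none).card) :
    bucketRound cfg L L 2 s =
      ({ s with groups := some (partition cfg.t (disclosures s.inbox)) },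
        broadcast (.partitionReq (partition cfg.t (disclosures s.inbox)))) := by
  simp only [bucketRound, h, if_true, dif_neg hv]
  rw [if_pos (by convert hd)]

theorem bucketRound_three_state : (bucketRound cfg L i 3 s).1 = s := by
  rw [bucketRound]
  (repeat' split) <;> rfl

theorem exists_bucketRound_three_send_partitionReply (h : s.started = true)
    (hgs : (s.inbox L).filterMap Msg.partitionReq? = [gs]) (hlen : gs.length ≤ maxGroups) :
    ∃ ns, (bucketRound cfg L i 3 s).2 = sendTo L (.partitionReply ns) ∧
      ∀ g ∈ gs, ¬(g.1 ≤ s.proposal ∧ s.proposal < g.2) →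
        (g, shareSign i (.group g.1 g.2)) ∈ ns := by
  refine ⟨(gs.filter fun g => decide (¬(g.1 ≤ s.proposal ∧ s.proposal < g.2))).map
    fun g => (g, shareSign i (.group g.1 g.2)), ?_, fun g hg hout => ?_⟩
  · simp only [bucketRound, h, if_true, hgs, List.find?, decide_eq_true hlen]
  · exact List.mem_map.2 ⟨g, List.mem_filter.2 ⟨hg, decide_eq_true hout⟩, rfl⟩

theorem exists_bucketRound_four_send_certificate (h : s.started = true)
    (ha : s.announced = false) (hgs : s.groups = some gs) (hlen : gs.length ≤ maxGroups)
    (hchain : IsGroupChain gs)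
    (hsigners : ∀ g ∈ gs, cfg.t + 1 ≤ (groupSigners s.inbox g).card) :
    ∃ c, Valid cfg.t c ∧ (bucketRound cfg L L 4 s).2 = broadcast (.certificate c) := by
  obtain ⟨C, hC, hvalid⟩ := exists_constructNegative_eq_some hlen hchain hsigners
  exact ⟨(cfg.defaultValue, C), hvalid, by simp [bucketRound, h, ha, hgs, hC]⟩

end BucketRounds

section PhaseRun

variable {n : ℕ} {V : Type u}

/-- The first `N` rounds of an execution, with the set `B` of faulty processes, of a phase that
starts with empty inboxes and in which correct process `i` runs the code `step i k` in round `k`.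
The round number in the state is kept outside of the phase and is left unspecified here; inboxes are
described by `inbox_eq`. -/
structure PhaseRun (step : Fin n → ℕ → LocalState n V → Action n V) (N : ℕ)
    (B : Finset (Fin n)) where
  state : ℕ → Fin n → LocalState n V
  sent : ℕ → Fin n → Fin n → List (Msg n V)
  sent_eq : ∀ k < N, ∀ i ∉ B, sent k i = (step i k (state k i)).2
  state_succ : ∀ k < N, ∀ i ∉ B, state (k + 1) i =
    { (step i k (state k i)).1 with
      round := (state (k + 1) i).round
      inbox := (state (k + 1) i).inbox }
  inbox_eq : ∀ k < N, ∀ i ∉ B, ∀ j,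
    (state k i).inbox j = (List.range k).flatMap fun l => sent l j i

/-- Every correct process has acquired a certificate. -/
def Certified (B : Finset (Fin n)) (σ : Fin n → LocalState n V) : Prop :=
  ∀ i ∉ B, (σ i).cert ≠ none

namespace PhaseRun

variable {step : Fin n → ℕ → LocalState n V → Action n V} {N : ℕ} {B : Finset (Fin n)}
  (P : PhaseRun step N B) {i j : Fin n} {k l : ℕ}
include P

theorem cert_succ (hk : k < N) (hi : i ∉ B) :
    (P.state (k + 1) i).cert = (step i k (P.state k i)).1.cert := by
  rw [P.state_succ k hk i hi]

theorem started_succ (hk : k < N) (hi : i ∉ B) :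
    (P.state (k + 1) i).started = (step i k (P.state k i)).1.started := by
  rw [P.state_succ k hk i hi]

theorem groups_succ (hk : k < N) (hi : i ∉ B) :
    (P.state (k + 1) i).groups = (step i k (P.state k i)).1.groups := by
  rw [P.state_succ k hk i hi]

theorem announced_succ (hk : k < N) (hi : i ∉ B) :
    (P.state (k + 1) i).announced = (step i k (P.state k i)).1.announced := by
  rw [P.state_succ k hk i hi]

theorem invariant {p : LocalState n V → Prop}
    (hp : ∀ s r inbox, p s → p { s with round := r, inbox := inbox }) (hi : i ∉ B) (hkl : k ≤ l)
    (hl : l ≤ N) (hstep : ∀ m, k ≤ m → m < l → ∀ s, p s → p (step i m s).1)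
    (h : p (P.state k i)) : p (P.state l i) := by
  induction l, hkl using Nat.le_induction with
  | base => exact h
  | succ l hkl ih =>
    rw [P.state_succ l hl i hi]
    exact hp _ _ _ (hstep l hkl l.lt_succ_self _
      (ih (by omega) fun m hkm hml => hstep m hkm (by omega)))

theorem mem_inbox (hk : k < N) (hi : i ∉ B) (hl : l < k) {m : Msg n V} (hm : m ∈ P.sent l j i) :
    m ∈ (P.state k i).inbox j := by
  rw [P.inbox_eq k hk i hi]
  exact List.mem_flatMap.2 ⟨l, List.mem_range.2 hl, hm⟩

/-- The number of words sent by correct processes in round `k` of the phase. -/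
def roundWords (k : ℕ) : ℕ := ∑ i ∈ Bᶜ, ∑ j, ((P.sent k i j).map Msg.words).sum

theorem roundWords_le (hk : k < N) (hshort : ∀ i ∉ B, IsShort (step i k (P.state k i)).2)
    (S : Finset (Fin n × Fin n)) (hS : ∀ i ∉ B, ∀ j, P.sent k i j ≠ [] → (i, j) ∈ S) :
    P.roundWords k ≤ maxMsgWords * S.card := by
  have hle : ∀ p ∈ Bᶜ ×ˢ Finset.univ,
      ((P.sent k p.1 p.2).map Msg.words).sum ≤ if p ∈ S then maxMsgWords else 0 := by
    rintro ⟨i, j⟩ hp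
    have hi : i ∉ B := Finset.mem_compl.1 (Finset.mem_product.1 hp).1
    split
    · rw [P.sent_eq k hk i hi]
      exact hshort i hi j
    · next h => simp [not_not.1 (mt (hS i hi j) h)]
  calc P.roundWords k = ∑ p ∈ Bᶜ ×ˢ Finset.univ, ((P.sent k p.1 p.2).map Msg.words).sum :=
        (Finset.sum_product _ _ fun p => ((P.sent k p.1 p.2).map Msg.words).sum).symm
    _ ≤ ∑ p ∈ Bᶜ ×ˢ Finset.univ, if p ∈ S then maxMsgWords else 0 := Finset.sum_le_sum hle
    _ ≤ ∑ p, if p ∈ S then maxMsgWords else 0 :=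
        Finset.sum_le_univ_sum_of_nonneg fun _ => Nat.zero_le _
    _ = maxMsgWords * S.card := by
        rw [Finset.sum_ite_mem, Finset.univ_inter, Finset.sum_const, smul_eq_mul, mul_comm]

theorem sum_roundWords_le (hshort : ∀ k < N, ∀ i ∉ B, IsShort (step i k (P.state k i)).2)
    (S : Finset (Fin n × Fin n)) (hS : ∀ k < N, ∀ i ∉ B, ∀ j, P.sent k i j ≠ [] → (i, j) ∈ S) :
    ∑ k ∈ Finset.range N, P.roundWords k ≤ N * (maxMsgWords * S.card) := by
  simpa using Finset.sum_le_card_nsmul (Finset.range N) P.roundWords _ fun k hk =>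
    P.roundWords_le (Finset.mem_range.1 hk) (hshort k (Finset.mem_range.1 hk)) S
      (hS k (Finset.mem_range.1 hk))

end PhaseRun

end PhaseRun

theorem le_card_add_card_of_forall_notMem {n : ℕ} {S B : Finset (Fin n)} (h : ∀ i ∉ B, i ∈ S) :
    n ≤ S.card + B.card := by
  have huniv : S ∪ B = Finset.univ := Finset.eq_univ_iff_forall.2 fun i =>
    Finset.mem_union.2 ((em (i ∈ B)).symm.imp_left (h i))
  simpa [huniv] using Finset.card_union_le S B

/-- One iteration of BUCKET, with leader `L`. -/
abbrev BucketIteration {n : ℕ} {V : Type u} [LinearOrder V] [BoundedOrder V] (cfg : Config V)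
    (L : Fin n) (B : Finset (Fin n)) :=
  PhaseRun (bucketRound cfg L) 6 B

namespace BucketIteration

variable {n : ℕ} {V : Type u} [LinearOrder V] [BoundedOrder V] {cfg : Config V} {L : Fin n}
  {B : Finset (Fin n)} (P : BucketIteration cfg L B) {i j : Fin n} {k : ℕ}
include P

theorem inbox_one (hi : i ∉ B) : (P.state 1 i).inbox j = P.sent 0 j i := by
  simp [P.inbox_eq 1 (by simp) i hi]

theorem cert_one (hi : i ∉ B) : (P.state 1 i).cert = (P.state 0 i).cert := by
  rw [P.cert_succ (by simp) hi, bucketRound_zero_state]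

theorem proposal_eq (hi : i ∉ B) (hk : k ≤ 6) :
    (P.state k i).proposal = (P.state 0 i).proposal :=
  P.invariant (p := fun s => s.proposal = (P.state 0 i).proposal) (fun _ _ _ h => h) hi k.zero_le hk
    (fun _ _ _ _ h => bucketRound_proposal.trans h) rfl

theorem started_eq_true_iff (hi : i ∉ B) (hk2 : 2 ≤ k) (hk : k ≤ 6) :
    (P.state k i).started = true ↔ Msg.aidReq ∈ P.sent 0 L i := by
  refine P.invariant (p := fun s => s.started = true ↔ Msg.aidReq ∈ P.sent 0 L i)
    (fun _ _ _ h => h) hi hk2 hk (fun m hm _ s h => ?_) ?_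
  · rwa [bucketRound_started (by omega)]
  · rw [P.started_succ (by simp) hi, bucketRound_one_started_eq_true_iff, P.inbox_one hi]

theorem cert_ne_none_of_le {l : ℕ} (hi : i ∉ B) (hkl : k ≤ l) (hl : l ≤ 6)
    (h : (P.state k i).cert ≠ none) : (P.state l i).cert ≠ none :=
  P.invariant (p := fun s => s.cert ≠ none) (fun _ _ _ h => h) hi hkl hl
    (fun _ _ _ _ h => bucketRound_cert_ne_none h) h

theorem sound (hn : n < 3 * (cfg.t + 1)) (hi : i ∉ B) (hk : k ≤ 6)
    (h : (P.state 0 i).Sound cfg.t) : (P.state k i).Sound cfg.t :=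
  P.invariant (fun _ _ _ h => ⟨h.valid, h.length_groups_le⟩) hi k.zero_le hk
    (fun _ _ _ _ h => h.bucketRound hn) h

theorem sent_zero (hi : i ∉ B) : P.sent 0 i j =
    if (P.state 0 i).cert = none ∧ (i = L ∨ j = L) then [.aidReq] else [] := by
  rw [P.sent_eq 0 (by simp) i hi, bucketRound_zero_send]

section LeaderCertified

variable (hL : L ∉ B) (hc : (P.state 0 L).cert ≠ none)
include hL hc

theorem aidReq_notMem_sent_zero : Msg.aidReq ∉ P.sent 0 L i := by
  simp [P.sent_zero hL, hc]

theorem not_started (hi : i ∉ B) (hk2 : 2 ≤ k) (hk : k ≤ 6) : ¬(P.state k i).started = true :=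
  mt (P.started_eq_true_iff hi hk2 hk).1 (P.aidReq_notMem_sent_zero hL hc)

open scoped Classical in
theorem sent_one (hi : i ∉ B) : P.sent 1 i j =
    if i = L ∧ Msg.aidReq ∈ P.sent 0 j i then [.aidReply (P.state 0 i).cert] else [] := by
  have hnot : Msg.aidReq ∉ (P.state 1 i).inbox L := by
    rw [P.inbox_one hi]
    exact P.aidReq_notMem_sent_zero hL hc
  rw [P.sent_eq 1 (by simp) i hi, bucketRound_one_send_of_notMem hnot, P.inbox_one hi,
    P.cert_one hi]

theorem sent_eq_nil_of_two_le (hi : i ∉ B) (hk2 : 2 ≤ k) (hk : k < 6) : P.sent k i j = [] := by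
  rw [P.sent_eq k hk i hi,
    bucketRound_send_of_not_started hk2 (P.not_started hL hc hi hk2 hk.le)]
  rfl

theorem certified_of_leader_certified (hs : (P.state 0 L).Sound cfg.t) :
    Certified B (P.state 6) := by
  classical
  intro i hi
  by_cases hci : (P.state 0 i).cert = none
  · obtain ⟨c, hcL⟩ := Option.ne_none_iff_exists'.1 hc
    have hreply : Msg.aidReply (some c) ∈ P.sent 1 L i := by
      simp [P.sent_one hL hc hL, P.sent_zero hi, hci, hcL]
    refine P.cert_ne_none_of_le hi (k := 3) (by simp) le_rfl ?_
    rw [P.cert_succ (by simp) hi]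
    exact bucketRound_two_cert_of_aidReply (P.not_started hL hc hi le_rfl (by simp))
      (P.mem_inbox (by simp) hi one_lt_two hreply) (hs.valid c hcL)
  · exact P.cert_ne_none_of_le hi (Nat.zero_le _) le_rfl hci

end LeaderCertified

theorem eq_leader_and_mem_of_sent_ne_nil (hL : L ∉ B) (hcert : Certified B (P.state 0))
    (hi : i ∉ B) (hk : k < 6) (h : P.sent k i j ≠ []) : i = L ∧ j ∈ B := by
  classical
  match k, hk with
  | 0, _ => simp [P.sent_zero hi, hcert i hi] at h
  | 1, _ =>
    rw [P.sent_one hL (hcert L hL) hi] at h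
    obtain ⟨hiL, hreq⟩ := of_not_not (mt (fun hnot => if_neg hnot) h)
    refine ⟨hiL, by_contra fun hj => ?_⟩
    simp [P.sent_zero hj, hcert j hj] at hreq
  | k + 2, hk => exact absurd (P.sent_eq_nil_of_two_le hL (hcert L hL) hi (by simp) hk) h

section LeaderUncertified

variable (hL : L ∉ B) (hc : (P.state 0 L).cert = none)
include hL hc

theorem aidReq_mem_sent_zero : Msg.aidReq ∈ P.sent 0 L i := by
  simp [P.sent_zero hL, hc]

theorem started (hi : i ∉ B) (hk2 : 2 ≤ k) (hk : k ≤ 6) : (P.state k i).started = true :=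
  (P.started_eq_true_iff hi hk2 hk).2 (P.aidReq_mem_sent_zero hL hc)

theorem sent_disclose (hi : i ∉ B) : P.sent 1 i =
    sendTo L (.disclose (P.state 0 i).proposal (shareSign i (.value (P.state 0 i).proposal))) := by
  have hreq : Msg.aidReq ∈ (P.state 1 i).inbox L := by
    rw [P.inbox_one hi]
    exact P.aidReq_mem_sent_zero hL hc
  rw [P.sent_eq 1 (by simp) i hi, bucketRound_one_send_of_mem hreq, P.proposal_eq hi (by simp)]

theorem disclosures_eq (hi : i ∉ B) :
    disclosures (P.state 2 L).inbox i = some (P.state 0 i).proposal := by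
  rw [disclosures, P.inbox_eq 2 (by simp) L hL]
  by_cases h : (P.state 0 i).cert = none <;>
    simp [List.range_succ, List.findSome?_cons, P.sent_disclose hL hc hi, P.sent_zero hi, h, sendTo,
      Msg.disclosed?, ShareVerify]

theorem certified_of_certificate_sent (hk : k < 5)
    (h : ∃ c, Valid cfg.t c ∧ P.sent k L = broadcast (.certificate c)) :
    Certified B (P.state 6) := by
  obtain ⟨c, hv, hsent⟩ := h
  intro i hi
  rw [P.cert_succ (by simp) hi]
  refine bucketRound_five_cert_of_certificate (P.started hL hc hi (by simp) (by simp))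
    (P.mem_inbox (by simp) hi hk ?_) hv
  rw [hsent]
  exact List.mem_singleton_self _

theorem mem_groupSigners {gs : List (V × V)} (hlen : gs.length ≤ maxGroups)
    (hsent : P.sent 2 L = broadcast (.partitionReq gs)) (hi : i ∉ B) {g : V × V} (hg : g ∈ gs)
    (hout : ¬(g.1 ≤ (P.state 0 i).proposal ∧ (P.state 0 i).proposal < g.2)) :
    i ∈ groupSigners (P.state 4 L).inbox g := by
  have hreq : ((P.state 3 i).inbox L).filterMap Msg.partitionReq? = [gs] := by
    rw [P.inbox_eq 3 (by simp) i hi]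
    by_cases hiL : i = L <;>
      simp [List.range_succ, List.filterMap_cons, P.sent_zero hL, P.sent_disclose hL hc hL, hsent,
        hc, hiL, sendTo, broadcast, Msg.partitionReq?]
  obtain ⟨ns, hns, hmem⟩ := exists_bucketRound_three_send_partitionReply (cfg := cfg) (i := i)
    (P.started hL hc hi (k := 3) (by simp) (by simp)) hreq hlen
  rw [← P.sent_eq 3 (by simp) i hi] at hns
  rw [← P.proposal_eq hi (k := 3) (by simp)] at hout
  simp only [groupSigners, Finset.mem_filter_univ]
  refine ⟨ns, _, ?_, hmem g hg hout, rfl⟩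
  exact P.mem_inbox (by simp) hL (l := 3) (by simp) (by simp [hns, sendTo])

theorem le_card_groupSigners {gs : List (V × V)} (hlen : gs.length ≤ maxGroups)
    (hsent : P.sent 2 L = broadcast (.partitionReq gs)) {g : V × V} (hg : g ∈ gs) :
    n ≤ (groupSigners (P.state 4 L).inbox g).card + B.card +
      groupCount (disclosures (P.state 2 L).inbox) g := by
  classical
  set inGroup := {j | ∃ v, disclosures (P.state 2 L).inbox j = some v ∧ g.1 ≤ v ∧ v < g.2}
  have hmem : ∀ i ∉ B ∪ inGroup.toFinset, i ∈ groupSigners (P.state 4 L).inbox g := by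
    intro i hi
    rw [Finset.mem_union, Set.mem_toFinset, not_or] at hi
    exact P.mem_groupSigners hL hc hlen hsent hi.1 hg fun h =>
      hi.2 ⟨_, P.disclosures_eq hL hc hi.1, h⟩
  have hcount : groupCount (disclosures (P.state 2 L).inbox) g = inGroup.toFinset.card :=
    Set.ncard_eq_toFinset_card' _
  have := le_card_add_card_of_forall_notMem hmem
  have := Finset.card_union_le B inGroup.toFinset
  omega

theorem certified_of_popular_value
    (h : ∃ v, cfg.t + 1 ≤ (disclosers (disclosures (P.state 2 L).inbox) v).card) :
    Certified B (P.state 6) := by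
  refine P.certified_of_certificate_sent hL hc (k := 2) (by simp) ?_
  rw [P.sent_eq 2 (by simp) L hL]
  exact exists_bucketRound_two_send_certificate (P.started hL hc hL le_rfl (by simp)) h

section FewFaults

variable (hB : B.card ≤ cfg.tO)
  (hfew : ¬∃ v, cfg.t + 1 ≤ (disclosers (disclosures (P.state 2 L).inbox) v).card)
include hB hfew

theorem exists_isPartition_disclosures (hn : 2 * cfg.t + 1 + cfg.tO ≤ n) :
    ∃ gs, IsPartition cfg.t (disclosures (P.state 2 L).inbox) gs := by
  have hnontrivial : Nontrivial V := by
    by_contra h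
    have := not_nontrivial_iff_subsingleton.1 h
    have hall : ∀ i ∉ B, i ∈ disclosers (disclosures (P.state 2 L).inbox) ⊥ := by
      intro i hi
      simpa only [disclosers, Finset.mem_filter_univ, P.disclosures_eq hL hc hi]
        using congrArg some (Subsingleton.elim _ ⊥)
    have := le_card_add_card_of_forall_notMem hall
    exact hfew ⟨⊥, by omega⟩
  exact exists_isPartition fun v => Nat.le_of_lt_succ (not_le.1 fun h => hfew ⟨v, h⟩)

theorem bucketRound_two_leader : bucketRound cfg L L 2 (P.state 2 L) =
    ({ P.state 2 L with groups := some (partition cfg.t (disclosures (P.state 2 L).inbox)) },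
      broadcast (.partitionReq (partition cfg.t (disclosures (P.state 2 L).inbox)))) := by
  classical
  refine bucketRound_two_of_no_popular_value (P.started hL hc hL le_rfl (by simp)) hfew ?_
  have := le_card_add_card_of_forall_notMem fun i (hi : i ∉ B) =>
    Finset.mem_filter.2 ⟨Finset.mem_univ i,
      ((P.disclosures_eq hL hc hi).trans_ne (Option.some_ne_none _))⟩
  omega

theorem certified_of_no_popular_value (hn : 2 * cfg.t + 1 + cfg.tO ≤ n)
    (hn3 : n < 3 * (cfg.t + 1)) : Certified B (P.state 6) := by
  have hround := P.bucketRound_two_leader hL hc hB hfew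
  obtain ⟨hchain, hcount, -⟩ := isPartition_partition
    (P.exists_isPartition_disclosures hL hc hB hfew hn)
  set gs := partition cfg.t (disclosures (P.state 2 L).inbox)
  have hlen : gs.length ≤ maxGroups := length_partition_le_maxGroups hn3 _
  have hsent : P.sent 2 L = broadcast (.partitionReq gs) := by
    rw [P.sent_eq 2 (by simp) L hL, hround]
  have hgroups : (P.state 4 L).groups = some gs := by
    rw [P.groups_succ (by simp) hL, bucketRound_three_state, P.groups_succ (by simp) hL, hround]
  have hannounced : (P.state 4 L).announced = false := by
    rw [P.announced_succ (by simp) hL, bucketRound_three_state, P.announced_succ (by simp) hL,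
      hround]
    dsimp only
    rw [P.announced_succ (by simp) hL, bucketRound_one_announced]
  have hsigners : ∀ g ∈ gs, cfg.t + 1 ≤ (groupSigners (P.state 4 L).inbox g).card := by
    intro g hg
    have := P.le_card_groupSigners hL hc hlen hsent hg
    have := hcount g hg
    omega
  refine P.certified_of_certificate_sent hL hc (k := 4) (by simp) ?_
  rw [P.sent_eq 4 (by simp) L hL]
  exact exists_bucketRound_four_send_certificate (P.started hL hc hL (by simp) (by simp))
    hannounced hgroups hlen hchain hsigners

end FewFaults

end LeaderUncertified

theorem certified_of_leader_correct (hL : L ∉ B) (hs : (P.state 0 L).Sound cfg.t)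
    (hB : B.card ≤ cfg.tO) (hn : 2 * cfg.t + 1 + cfg.tO ≤ n) (hn3 : n < 3 * (cfg.t + 1)) :
    Certified B (P.state 6) := by
  by_cases hc : (P.state 0 L).cert = none
  · by_cases hv : ∃ v, cfg.t + 1 ≤ (disclosers (disclosures (P.state 2 L).inbox) v).card
    · exact P.certified_of_popular_value hL hc hv
    · exact P.certified_of_no_popular_value hL hc hB hv hn hn3
  · exact P.certified_of_leader_certified hL hc hs

section Words

variable (hn : n < 3 * (cfg.t + 1)) (hs : ∀ i ∉ B, (P.state 0 i).Sound cfg.t)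
include hn hs

theorem sum_roundWords_le_mul_card :
    ∑ k ∈ Finset.range 6, P.roundWords k ≤ 6 * (maxMsgWords * (2 * n)) := by
  classical
  set S : Finset (Fin n × Fin n) := {L} ×ˢ Finset.univ ∪ Finset.univ ×ˢ {L}
  have hS : S.card ≤ 2 * n := (Finset.card_union_le _ _).trans_eq <| by
    simp only [Finset.card_product, Finset.card_singleton, Finset.card_univ, Fintype.card_fin]
    ring
  refine (P.sum_roundWords_le (fun k hk i hi => isShort_bucketRound hn
    (P.sound hn hi hk.le (hs i hi))) S fun k hk i hi j h => ?_).trans (by gcongr)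
  by_contra hmem
  have hij : i ≠ L ∧ j ≠ L := by simpa [S, eq_comm] using hmem
  exact h ((congrFun (P.sent_eq k hk i hi) j).trans (bucketRound_send_eq_nil hij.1 hij.2))

theorem sum_roundWords_le_mul_card_faulty (hL : L ∉ B) (hcert : Certified B (P.state 0)) :
    ∑ k ∈ Finset.range 6, P.roundWords k ≤ 6 * (maxMsgWords * B.card) := by
  refine (P.sum_roundWords_le (fun k hk i hi => isShort_bucketRound hn
    (P.sound hn hi hk.le (hs i hi))) ({L} ×ˢ B) fun k hk i hi j h => ?_).trans_eq (by simp)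
  obtain ⟨hiL, hj⟩ := P.eq_leader_and_mem_of_sent_ne_nil hL hcert hi hk h
  exact Finset.mem_product.2 ⟨Finset.mem_singleton.2 hiL, hj⟩

end Words

end BucketIteration

theorem mem_allMsgs {n : ℕ} {V : Type u} {inbox : Fin n → List (Msg n V)} {j : Fin n} {m : Msg n V}
    (h : m ∈ inbox j) : m ∈ allMsgs inbox :=
  List.mem_flatMap.2 ⟨j, List.mem_finRange j, h⟩

section AgreementRounds

variable {n : ℕ} {V : Type u} [LinearOrder V] [BoundedOrder V] {cfg : Config V} {i j : Fin n}
  {k : ℕ} {s : LocalState n V} {c : V × Certificate n V}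

theorem agreementRound_state_of_cert (h : s.cert ≠ none) : (agreementRound cfg i k s).1 = s := by
  fun_cases agreementRound <;> first | rfl | contradiction

theorem agreementRound_send_of_cert (hk : k ≠ 1) (h : s.cert ≠ none) :
    (agreementRound cfg i k s).2 = silent := by
  fun_cases agreementRound <;> first | rfl | contradiction | exact if_neg h

theorem agreementRound_two_cert_of_helpReply {sig : PSig n (Content V)}
    (hc : Msg.helpReply (some c) sig ∈ s.inbox j) (hv : Valid cfg.t c) :
    (agreementRound cfg i 2 s).1.cert ≠ none := by
  by_cases h : s.cert = none
  · have hne := firstValid_ne_none (List.mem_filterMap.2 ⟨_, mem_allMsgs hc, rfl⟩ :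
      c ∈ (allMsgs s.inbox).filterMap Msg.helpReply?) hv
    simp only [agreementRound, h, if_true]
    split
    · exact Option.some_ne_none _
    · contradiction
  · exact agreementRound_cert_ne_none h

theorem agreementRound_two_send_of_relay (hrelay : cfg.relay = true) (h : s.cert = none) :
    (∃ c, Valid cfg.t c ∧ (agreementRound cfg i 2 s).2 = broadcast (.finalCertificate c)) ∨
      (agreementRound cfg i 2 s).2 = broadcast (.allowAny (shareSign i .anyValue)) := by
  simp only [agreementRound, h, if_true, hrelay]
  split
  · exact .inl ⟨_, valid_of_firstValid_eq_some ‹_›, rfl⟩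
  · split_ifs with hv
    · exact .inl ⟨_, valid_combine_value hv.choose_spec, rfl⟩
    · exact .inr rfl

theorem agreementRound_three_cert_ne_none : (agreementRound cfg i 3 s).1.cert ≠ none := by
  by_cases h : s.cert = none
  · simp only [agreementRound, h, if_true]
    split <;> exact Option.some_ne_none _
  · exact agreementRound_cert_ne_none h

theorem valid_agreementRound_three (h : s.cert = none)
    (hs : (∀ j c, Valid cfg.t c → Msg.finalCertificate c ∉ s.inbox j) →
      cfg.t + 1 ≤ (allowAnySigners s.inbox).card) :
    ∀ c ∈ (agreementRound cfg i 3 s).1.cert, Valid cfg.t c := by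
  simp only [agreementRound, h, if_true]
  split
  · rintro _ ⟨⟩
    exact valid_of_firstValid_eq_some ‹_›
  · rintro _ ⟨⟩
    refine valid_combine_anyValue (hs fun j c hv hm => ?_)
    exact firstValid_ne_none (List.mem_filterMap.2 ⟨_, mem_allMsgs hm, rfl⟩) hv ‹_›

end AgreementRounds

/-- The four rounds of STRONG between BUCKET and EBA. -/
abbrev AgreementPhase {n : ℕ} {V : Type u} [LinearOrder V] [BoundedOrder V] (cfg : Config V)
    (B : Finset (Fin n)) :=
  PhaseRun (agreementRound cfg) 4 B

namespace AgreementPhase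

variable {n : ℕ} {V : Type u} [LinearOrder V] [BoundedOrder V] {cfg : Config V}
  {B : Finset (Fin n)} (P : AgreementPhase cfg B) {i j : Fin n} {k : ℕ}
include P

theorem cert_ne_none_of_le {l : ℕ} (hi : i ∉ B) (hkl : k ≤ l) (hl : l ≤ 4)
    (h : (P.state k i).cert ≠ none) : (P.state l i).cert ≠ none :=
  P.invariant (p := fun s => s.cert ≠ none) (fun _ _ _ h => h) hi hkl hl
    (fun _ _ _ _ h => agreementRound_cert_ne_none h) h

theorem sound (hi : i ∉ B) (hk : k ≤ 3) (h : (P.state 0 i).Sound cfg.t) :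
    (P.state k i).Sound cfg.t :=
  P.invariant (fun _ _ _ h => ⟨h.valid, h.length_groups_le⟩) hi k.zero_le (by omega)
    (fun _ _ _ _ h => h.agreementRound (by omega)) h

theorem cert_four_ne_none (hi : i ∉ B) : (P.state 4 i).cert ≠ none := by
  rw [P.cert_succ (by simp) hi]
  exact agreementRound_three_cert_ne_none

theorem inbox_one (hi : i ∉ B) : (P.state 1 i).inbox j = P.sent 0 j i := by
  simp [P.inbox_eq 1 (by simp) i hi]

theorem sent_zero (hi : i ∉ B) :
    P.sent 0 i j = if (P.state 0 i).cert = none then [.helpReq] else [] := by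
  rw [P.sent_eq 0 (by simp) i hi]
  simp only [agreementRound]
  split <;> rfl

theorem mem_of_sent_ne_nil (hcert : Certified B (P.state 0)) (hi : i ∉ B) (hk : k < 4)
    (h : P.sent k i j ≠ []) : j ∈ B := by
  have hck := P.cert_ne_none_of_le hi k.zero_le hk.le (hcert i hi)
  rw [P.sent_eq k hk i hi] at h
  by_cases hk1 : k = 1
  · subst hk1
    by_contra hj
    simp [agreementRound, P.inbox_one hi, P.sent_zero hj, hcert j hj] at h
  · exact absurd (congrFun (agreementRound_send_of_cert hk1 hck) j) h

section LateProcess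

variable (hs : ∀ i ∉ B, (P.state 0 i).Sound cfg.t) (hi : i ∉ B) (hc : (P.state 3 i).cert = none)
include hs hi hc

theorem cert_one_eq_none_of_cert_three_eq_none (hj : j ∉ B) : (P.state 1 j).cert = none := by
  by_contra hne
  obtain ⟨c, hcj⟩ := Option.ne_none_iff_exists'.1 hne
  have hci : (P.state 0 i).cert = none :=
    by_contra fun h => P.cert_ne_none_of_le hi (Nat.zero_le 3) (by simp) h hc
  have hreq : Msg.helpReq ∈ (P.state 1 j).inbox i := by
    simp [P.inbox_one hj, P.sent_zero hi, hci]
  have hreply : Msg.helpReply (some c) (shareSign j (.value (P.state 1 j).proposal)) ∈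
      P.sent 1 j i := by
    rw [P.sent_eq 1 (by simp) j hj]
    simp [agreementRound, hreq, hcj]
  rw [P.cert_succ (by simp) hi] at hc
  exact agreementRound_two_cert_of_helpReply (P.mem_inbox (by simp) hi one_lt_two hreply)
    ((P.sound hj (by simp) (hs j hj)).valid c hcj) hc

theorem mem_inbox_three_of_relay (hrelay : cfg.relay = true) (hj : j ∉ B) :
    (∃ c, Valid cfg.t c ∧ Msg.finalCertificate c ∈ (P.state 3 i).inbox j) ∨
      Msg.allowAny (shareSign j .anyValue) ∈ (P.state 3 i).inbox j := by
  have hcj : (P.state 2 j).cert = none := by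
    rw [P.cert_succ (by simp) hj]
    exact P.cert_one_eq_none_of_cert_three_eq_none hs hi hc hj
  have hround := agreementRound_two_send_of_relay (i := j) hrelay hcj
  rw [← P.sent_eq 2 (by simp) j hj] at hround
  rcases hround with ⟨c, hv, h⟩ | h
  · exact .inl ⟨c, hv, P.mem_inbox (by simp) hi (l := 2) (by simp) (by simp [h, broadcast])⟩
  · exact .inr (P.mem_inbox (by simp) hi (l := 2) (by simp) (by simp [h, broadcast]))

theorem lt_card_allowAnySigners (hrelay : cfg.relay = true) (hB : cfg.t + 1 + B.card ≤ n)
    (hno : ∀ j c, Valid cfg.t c → Msg.finalCertificate c ∉ (P.state 3 i).inbox j) :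
    cfg.t + 1 ≤ (allowAnySigners (P.state 3 i).inbox).card := by
  have hall : ∀ j ∉ B, j ∈ allowAnySigners (P.state 3 i).inbox := by
    intro j hj
    rcases P.mem_inbox_three_of_relay hs hi hc hrelay hj with ⟨c, hv, hm⟩ | hm
    · exact absurd hm (hno j c hv)
    · simp only [allowAnySigners, Finset.mem_filter_univ]
      exact ⟨_, hm, rfl⟩
  have := le_card_add_card_of_forall_notMem hall
  omega

end LateProcess

theorem valid_cert_four (hs : ∀ i ∉ B, (P.state 0 i).Sound cfg.t) (hB : cfg.t + 1 + B.card ≤ n)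
    (h : Certified B (P.state 0) ∨ cfg.relay = true) (hi : i ∉ B) :
    ∀ c ∈ (P.state 4 i).cert, Valid cfg.t c := by
  rw [P.cert_succ (by simp) hi]
  by_cases hc : (P.state 3 i).cert = none
  · rcases h with hcert | hrelay
    · exact absurd hc (P.cert_ne_none_of_le hi (Nat.zero_le 3) (by simp) (hcert i hi))
    · exact valid_agreementRound_three hc (P.lt_card_allowAnySigners hs hi hc hrelay hB)
  · rw [agreementRound_state_of_cert hc]
    exact (P.sound hi le_rfl (hs i hi)).valid

section Words

variable (hs : ∀ i ∉ B, (P.state 0 i).Sound cfg.t)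
include hs

theorem sum_roundWords_le_mul_sq :
    ∑ k ∈ Finset.range 4, P.roundWords k ≤ 4 * (maxMsgWords * (n * n)) := by
  refine (P.sum_roundWords_le (fun k hk i hi => isShort_agreementRound
    (P.sound hi (by omega) (hs i hi))) Finset.univ fun _ _ _ _ _ _ => Finset.mem_univ _).trans_eq ?_
  simp

theorem sum_roundWords_le_mul_card_faulty (hcert : Certified B (P.state 0)) :
    ∑ k ∈ Finset.range 4, P.roundWords k ≤ 4 * (maxMsgWords * (n * B.card)) := by
  refine (P.sum_roundWords_le (fun k hk i hi => isShort_agreementRound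
    (P.sound hi (by omega) (hs i hi))) (Finset.univ ×ˢ B)
    fun k hk i hi j h => ?_).trans_eq (by simp)
  exact Finset.mem_product.2 ⟨Finset.mem_univ _, P.mem_of_sent_ne_nil hcert hi hk h⟩

end Words

end AgreementPhase

theorem exists_notMem_forall_lt_mem {n : ℕ} {B : Finset (Fin n)} (hB : B.card < n) :
    ∃ i ∉ B, i.val ≤ B.card ∧ ∀ j < i, j ∈ B := by
  have hne : Bᶜ.Nonempty := by
    rw [← Finset.card_pos, Finset.card_compl, Fintype.card_fin]
    omega
  have hlt : ∀ j < Bᶜ.min' hne, j ∈ B := fun j hj =>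
    Finset.notMem_compl.1 fun h => hj.not_ge (Finset.min'_le _ _ h)
  refine ⟨_, Finset.mem_compl.1 (Bᶜ.min'_mem hne), ?_, hlt⟩
  rw [← Fin.card_Iio]
  exact Finset.card_le_card fun j hj => hlt j (Finset.mem_Iio.1 hj)

theorem sum_range_mul {M : Type*} [AddCommMonoid M] (f : ℕ → M) (a m : ℕ) :
    ∑ r ∈ Finset.range (a * m), f r =
      ∑ q ∈ Finset.range m, ∑ k ∈ Finset.range a, f (a * q + k) := by
  induction m with
  | zero => rfl
  | succ m ih => rw [Nat.mul_succ, Finset.sum_range_add, ih, Finset.sum_range_succ]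

section LocalRound

variable {n : ℕ} {V : Type u} [LinearOrder V] [BoundedOrder V] {cfg : Config V} {i : Fin n}
  {k : ℕ} {s : LocalState n V}

theorem localRound_eq_bucketRound {L : Fin n} (hL : L.val ≤ cfg.tO) (hk : k < 6)
    (hs : s.round = 6 * L + k) : localRound cfg i s = bucketRound cfg L i k s := by
  have hdiv : s.round / 6 = L := by omega
  have hmod : s.round % 6 = k := by omega
  have hlt : s.round < bucketLength cfg := by
    unfold bucketLength
    omega
  simp only [localRound, hlt, hdiv, hmod, L.isLt, if_true, dif_pos]

theorem localRound_eq_agreementRound (hs : s.round = bucketLength cfg + k) :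
    localRound cfg i s = agreementRound cfg i k s := by
  rw [localRound, if_neg (by omega), hs, Nat.add_sub_cancel_left]

end LocalRound

/-- An execution of STRONG with `E` as its EBA protocol and faulty processes `B`. -/
abbrev StrongExecution {n : ℕ} {V : Type u} [LinearOrder V] [BoundedOrder V] (cfg : Config V)
    (E : EBAProtocol n V) (B : Finset (Fin n)) :=
  Execution (strong cfg E) B

namespace StrongExecution

section Local

variable {n : ℕ} {V : Type u} [LinearOrder V] [BoundedOrder V] {cfg : Config V}
  {E : EBAProtocol n V} {B : Finset (Fin n)} (α : StrongExecution cfg E B) {i j L : Fin n}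
  {k m r : ℕ}

/-- The variables of BUCKET and of the agreement phase. -/
def localState (r : ℕ) (i : Fin n) : LocalState n V := (α.state r i).1

/-- The messages of BUCKET and of the agreement phase, without those of EBA that faulty processes
may send at any time. -/
def localSent (r : ℕ) (i j : Fin n) : List (Msg n V) :=
  List.filterMap (α := Msg n V ⊕ E.Msg) Sum.getLeft? (α.sent r i j)

theorem round_eq (hi : i ∉ B) (r : ℕ) : (α.localState r i).round = r := by
  induction r with
  | zero => rw [localState, α.state_zero i hi]; rfl
  | succ r ih =>
    rw [localState, α.state_succ r i hi]
    exact congrArg (· + 1) ih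

theorem sent_eq_map_inl (hi : i ∉ B) (hr : r < ebaStart cfg) (j : Fin n) :
    α.sent r i j = ((localRound cfg i (α.localState r i)).2 j).map Sum.inl := by
  rw [α.sent_correct r i hi j]
  exact if_pos (by rwa [← localState, α.round_eq hi])

theorem localSent_eq (hi : i ∉ B) (hr : r < ebaStart cfg) :
    α.localSent r i = (localRound cfg i (α.localState r i)).2 := by
  funext j
  rw [localSent, α.sent_eq_map_inl hi hr, List.filterMap_map]
  exact List.filterMap_some

theorem localState_succ (hi : i ∉ B) (r : ℕ) : α.localState (r + 1) i =
    { (localRound cfg i (α.localState r i)).1 with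
      round := (α.localState r i).round + 1
      inbox := fun j => if ((α.localState r i).round + 1) % 6 = 0 then []
        else (α.localState r i).inbox j ++ α.localSent r j i } := by
  rw [localState, α.state_succ r i hi]
  rfl

theorem inbox_six_mul (hi : i ∉ B) (m : ℕ) (j : Fin n) :
    (α.localState (6 * m) i).inbox j = [] := by
  cases m with
  | zero => rw [localState, α.state_zero i hi]; rfl
  | succ m =>
    rw [Nat.mul_succ, α.localState_succ hi, α.round_eq hi]
    exact if_pos (by omega)

theorem inbox_six_mul_add (hi : i ∉ B) (m : ℕ) (hk : k < 6) (j : Fin n) :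
    (α.localState (6 * m + k) i).inbox j =
      (List.range k).flatMap fun l => α.localSent (6 * m + l) j i := by
  induction k with
  | zero => exact α.inbox_six_mul hi m j
  | succ k ih =>
    rw [← add_assoc, α.localState_succ hi, α.round_eq hi, List.range_succ, List.flatMap_append,
      ← ih (by omega), List.flatMap_singleton]
    exact if_neg (by omega)

/-- The phase of `N ≤ 6` rounds that starts in round `6 * m` with empty inboxes. -/
def phaseRun (step : Fin n → ℕ → LocalState n V → Action n V) (N m : ℕ) (hN : N ≤ 6)
    (hm : 6 * m + N ≤ ebaStart cfg)
    (hstep : ∀ i, ∀ k < N, ∀ s, s.round = 6 * m + k → localRound cfg i s = step i k s) :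
    PhaseRun step N B where
  state k := α.localState (6 * m + k)
  sent k := α.localSent (6 * m + k)
  sent_eq k hk i hi := by
    rw [α.localSent_eq hi (by omega), hstep i k hk _ (α.round_eq hi _)]
  state_succ k hk i hi := by
    rw [← add_assoc, α.localState_succ hi, hstep i k hk _ (α.round_eq hi _)]
  inbox_eq k hk i hi := α.inbox_six_mul_add hi m (by omega)

/-- The iteration of BUCKET with leader `L`. -/
noncomputable def bucketIteration (L : Fin n) (hL : L.val ≤ cfg.tO) : BucketIteration cfg L B :=
  α.phaseRun (bucketRound cfg L) 6 L le_rfl (by unfold ebaStart bucketLength; omega)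
    fun _ _ hk _ hs => localRound_eq_bucketRound hL hk hs

/-- The four rounds between BUCKET and EBA. -/
noncomputable def agreementPhase : AgreementPhase cfg B :=
  α.phaseRun (agreementRound cfg) 4 (cfg.tO + 1) (by norm_num) le_rfl
    fun _ _ _ _ hs => localRound_eq_agreementRound hs

theorem cert_ebaStart_ne_none (hi : i ∉ B) : (α.localState (ebaStart cfg) i).cert ≠ none :=
  α.agreementPhase.cert_four_ne_none hi

theorem sound (htO : cfg.tO < n) (hn : n < 3 * (cfg.t + 1)) (hi : i ∉ B) (hm : m ≤ cfg.tO + 1) :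
    (α.localState (6 * m) i).Sound cfg.t := by
  induction m with
  | zero =>
    have hinit : α.localState 0 i = (α.state 0 i).1 := rfl
    rw [mul_zero, hinit, α.state_zero i hi]
    exact ⟨by simp [strong], by simp [strong]⟩
  | succ m ih =>
    exact (α.bucketIteration ⟨m, by omega⟩ (Nat.le_of_lt_succ hm)).sound hn hi le_rfl
      (ih (by omega))

theorem certified_mono (htO : cfg.tO < n) {l : ℕ} (hlm : l ≤ m) (hm : m ≤ cfg.tO + 1)
    (h : Certified B (α.localState (6 * l))) : Certified B (α.localState (6 * m)) := by
  induction m, hlm using Nat.le_induction with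
  | base => exact h
  | succ m _ ih =>
    exact fun i hi => (α.bucketIteration ⟨m, by omega⟩ (Nat.le_of_lt_succ hm)).cert_ne_none_of_le hi
      (Nat.zero_le 6) le_rfl (ih (by omega) i hi)

section FewFaults

variable (hn : 2 * cfg.t + 1 + cfg.tO ≤ n) (hn3 : n < 3 * (cfg.t + 1)) (hB : B.card ≤ cfg.tO)
include hn hn3 hB

theorem certified_of_leader_lt (hL : L ∉ B) (hLm : L < m) (hm : m ≤ cfg.tO + 1) :
    Certified B (α.localState (6 * m)) :=
  α.certified_mono (by omega) hLm hm <| (α.bucketIteration L (by omega)).certified_of_leader_correct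
    hL (α.sound (by omega) hn3 hL (by omega)) hB hn hn3

theorem certified_bucketLength : Certified B (α.localState (bucketLength cfg)) := by
  obtain ⟨L, hL, hLB, -⟩ := exists_notMem_forall_lt_mem (B := B) (by omega)
  exact α.certified_of_leader_lt hn hn3 hB hL (by omega) le_rfl

end FewFaults

/-- The iterations of BUCKET in which correct processes may send more than `O(f)` words: those with
a faulty leader, and those that start with some correct process lacking a certificate. -/
def Busy (m : ℕ) : Prop :=
  m ∈ B.map Fin.valEmbedding ∨ ¬Certified B (α.localState (6 * m))

open scoped Classical in
theorem card_busy_le (hn : 2 * cfg.t + 1 + cfg.tO ≤ n) (hn3 : n < 3 * (cfg.t + 1)) :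
    ((Finset.range (cfg.tO + 1)).filter α.Busy).card ≤ B.card + 1 := by
  rcases lt_or_ge cfg.tO B.card with hB | hB
  · refine (Finset.card_filter_le _ _).trans ?_
    rw [Finset.card_range]
    omega
  · obtain ⟨L, hL, -, hmin⟩ := exists_notMem_forall_lt_mem (B := B) (by omega)
    have hsub : (Finset.range (cfg.tO + 1)).filter α.Busy ⊆
        insert L.val (B.map Fin.valEmbedding) := by
      intro m hm
      obtain ⟨hm, hfaulty | huncert⟩ := Finset.mem_filter.1 hm
      · exact Finset.mem_insert_of_mem hfaulty
      · have hmt : m < cfg.tO + 1 := Finset.mem_range.1 hm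
        have hle : m ≤ L := not_lt.1 fun hlt =>
          huncert (α.certified_of_leader_lt hn hn3 hB hL hlt hmt.le)
        rcases hle.eq_or_lt with rfl | hlt
        · exact Finset.mem_insert_self _ _
        · exact Finset.mem_insert_of_mem <|
            Finset.mem_map_of_mem Fin.valEmbedding (hmin ⟨m, by omega⟩ hlt)
    refine (Finset.card_le_card hsub).trans ((Finset.card_insert_le _ _).trans_eq ?_)
    rw [Finset.card_map]

/-- The number of words of BUCKET and of the agreement phase sent by correct processes in
round `r`. -/
def localWords (r : ℕ) : ℕ := ∑ i ∈ Bᶜ, ∑ j, ((α.localSent r i j).map Msg.words).sum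

open scoped Classical in
theorem sum_localWords_iteration_le (htO : cfg.tO < n) (hn : n < 3 * (cfg.t + 1))
    (hm : m ≤ cfg.tO) :
    ∑ k ∈ Finset.range 6, α.localWords (6 * m + k) ≤
      (if α.Busy m then 12 * (maxMsgWords * n) else 0) + 6 * (maxMsgWords * B.card) := by
  set P := α.bucketIteration ⟨m, by omega⟩ hm
  have hs : ∀ i ∉ B, (P.state 0 i).Sound cfg.t := fun i hi =>
    α.sound htO hn hi (Nat.le_succ_of_le hm)
  split_ifs with hbusy
  · exact (P.sum_roundWords_le_mul_card hn hs).trans (Nat.le_add_right_of_le (by linarith))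
  · rw [Busy, not_or, not_not] at hbusy
    rw [zero_add]
    exact P.sum_roundWords_le_mul_card_faulty hn hs
      (fun hL => hbusy.1 (Finset.mem_map_of_mem Fin.valEmbedding hL)) hbusy.2

theorem sum_localWords_bucket_le (hn : 2 * cfg.t + 1 + cfg.tO ≤ n) (hn3 : n < 3 * (cfg.t + 1)) :
    ∑ r ∈ Finset.range (bucketLength cfg), α.localWords r ≤
      18 * (maxMsgWords * (n * (B.card + 1))) := by
  classical
  have htO : cfg.tO + 1 ≤ n := by omega
  calc ∑ r ∈ Finset.range (bucketLength cfg), α.localWords r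
      = ∑ m ∈ Finset.range (cfg.tO + 1), ∑ k ∈ Finset.range 6, α.localWords (6 * m + k) :=
        sum_range_mul _ _ _
    _ ≤ ∑ m ∈ Finset.range (cfg.tO + 1),
          ((if α.Busy m then 12 * (maxMsgWords * n) else 0) + 6 * (maxMsgWords * B.card)) :=
        Finset.sum_le_sum fun m hm =>
          α.sum_localWords_iteration_le htO hn3 (Nat.le_of_lt_succ (Finset.mem_range.1 hm))
    _ = ((Finset.range (cfg.tO + 1)).filter α.Busy).card * (12 * (maxMsgWords * n)) +
          (cfg.tO + 1) * (6 * (maxMsgWords * B.card)) := by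
        rw [Finset.sum_add_distrib, ← Finset.sum_filter]
        simp only [Finset.sum_const, smul_eq_mul, Finset.card_range]
    _ ≤ (B.card + 1) * (12 * (maxMsgWords * n)) + n * (6 * (maxMsgWords * (B.card + 1))) := by
        gcongr
        · exact α.card_busy_le hn hn3
        · exact Nat.le_succ _
    _ = 18 * (maxMsgWords * (n * (B.card + 1))) := by ring

theorem sum_localWords_agreement_le (hn : 2 * cfg.t + 1 + cfg.tO ≤ n)
    (hn3 : n < 3 * (cfg.t + 1)) {D : ℕ} (hD : cfg.tO < B.card → n ≤ D * (B.card + 1)) :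
    ∑ k ∈ Finset.range 4, α.localWords (bucketLength cfg + k) ≤
      4 * (maxMsgWords * (n * ((D + 1) * (B.card + 1)))) := by
  have hs : ∀ i ∉ B, (α.agreementPhase.state 0 i).Sound cfg.t := fun i hi =>
    α.sound (by omega) hn3 hi le_rfl
  rcases lt_or_ge cfg.tO B.card with hB | hB
  · refine (α.agreementPhase.sum_roundWords_le_mul_sq hs).trans ?_
    gcongr
    exact (hD hB).trans (Nat.mul_le_mul_right _ D.le_succ)
  · refine (α.agreementPhase.sum_roundWords_le_mul_card_faulty hs
      (α.certified_bucketLength hn hn3 hB)).trans ?_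
    gcongr
    exact (Nat.le_succ _).trans (Nat.le_mul_of_pos_left _ D.succ_pos)

theorem sum_localWords_le (hn : 2 * cfg.t + 1 + cfg.tO ≤ n) (hn3 : n < 3 * (cfg.t + 1)) {D : ℕ}
    (hD : cfg.tO < B.card → n ≤ D * (B.card + 1)) :
    ∑ r ∈ Finset.range (ebaStart cfg), α.localWords r ≤
      (18 + 4 * (D + 1)) * maxMsgWords * n * (B.card + 1) := by
  rw [ebaStart, Finset.sum_range_add]
  exact (Nat.add_le_add (α.sum_localWords_bucket_le hn hn3)
    (α.sum_localWords_agreement_le hn hn3 hD)).trans_eq (by ring)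

end Local

end StrongExecution

section Complexity

variable {n : ℕ} {In Out : Type u} {P : Protocol n In Out} {B : Finset (Fin n)}
  (α : Execution P B)

theorem Execution.wordsBefore_mono : Monotone α.wordsBefore := fun _ _ h =>
  Finset.sum_le_sum_of_subset (Finset.range_mono h)

theorem Execution.wordsBefore_le_wordComplexity {Legal : In → Prop}
    (h : ∀ i, i ∉ B → Legal (α.input i)) (R : ℕ) :
    (α.wordsBefore R : ℕ∞) ≤ P.wordComplexity Legal B.card :=
  (le_iSup (fun R : ℕ => (α.wordsBefore R : ℕ∞)) R).trans
    (le_iSup₂_of_le B rfl (le_iSup₂_of_le α h le_rfl))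

end Complexity

namespace StrongExecution

variable {n : ℕ} {V : Type u} [LinearOrder V] [BoundedOrder V] {cfg : Config V}
  {E : EBAProtocol n V} {B : Finset (Fin n)} (α : StrongExecution cfg E B) {i : Fin n} {r : ℕ}

/-- The messages of EBA. -/
def ebaSent (r : ℕ) (i j : Fin n) : List E.Msg :=
  List.filterMap (α := Msg n V ⊕ E.Msg) Sum.getRight? (α.sent r i j)

theorem sent_eq_map_inr (hi : i ∉ B) (hr : ebaStart cfg ≤ r) (j : Fin n) :
    α.sent r i j = ((α.state r i).2.elim [] fun e => E.send i e j).map Sum.inr := by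
  rw [α.sent_correct r i hi j]
  exact if_neg (by rw [← localState, α.round_eq hi]; omega)

theorem ebaSent_eq (hi : i ∉ B) (hr : ebaStart cfg ≤ r) (j : Fin n) :
    α.ebaSent r i j = (α.state r i).2.elim [] fun e => E.send i e j := by
  rw [ebaSent, α.sent_eq_map_inr hi hr, List.filterMap_map]
  exact List.filterMap_some

theorem eba_state_ebaStart (hi : i ∉ B) :
    (α.state (ebaStart cfg) i).2 = (α.localState (ebaStart cfg) i).cert.map (E.start i) := by
  have hround : (α.state (bucketLength cfg + 3) i).1.round = _ := α.round_eq hi _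
  have hsucc : ebaStart cfg = bucketLength cfg + 3 + 1 := rfl
  rw [localState, hsucc, α.state_succ _ i hi]
  exact (if_neg (by rw [hround, hsucc]; omega)).trans (if_pos (by rw [hround, hsucc]))

theorem eba_state_succ (hi : i ∉ B) (hr : ebaStart cfg ≤ r) :
    (α.state (r + 1) i).2 =
      (α.state r i).2.map fun e => E.recv i e fun j => α.ebaSent r j i := by
  have hround : (α.state r i).1.round = r := α.round_eq hi r
  rw [α.state_succ r i hi]
  exact (if_neg (by rw [hround]; omega)).trans (if_neg (by rw [hround]; omega))

theorem eba_state_ne_none (hi : i ∉ B) (r : ℕ) : (α.state (ebaStart cfg + r) i).2 ≠ none := by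
  induction r with
  | zero =>
    rw [add_zero, α.eba_state_ebaStart hi]
    exact Option.map_eq_none_iff.not.2 (α.cert_ebaStart_ne_none hi)
  | succ r ih =>
    rw [← add_assoc, α.eba_state_succ hi (Nat.le_add_right _ _)]
    exact Option.map_eq_none_iff.not.2 ih

theorem exists_mem_ebaSent_of_mem_shares {s : PSig n E.Content} (hs : s.signer ∉ B) {j : Fin n}
    {m : (strong cfg E).Msg} (hm : m ∈ α.sent r s.signer j)
    (hsm : ⟨s.signer, Sum.inr s.content⟩ ∈ (strong cfg E).shares m) :
    ebaStart cfg ≤ r ∧ ∃ m' ∈ α.ebaSent r s.signer j, s ∈ E.shares m' := by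
  rcases m with m | m
  · obtain ⟨p, -, hp⟩ := hsm
    exact absurd (congrArg PSig.content hp) Sum.inl_ne_inr
  · refine ⟨not_lt.1 fun hr => ?_, m, List.mem_filterMap.2 ⟨_, hm, rfl⟩, ?_⟩
    · rw [α.sent_eq_map_inl hs hr] at hm
      obtain ⟨_, -, h⟩ := List.mem_map.1 hm
      exact Sum.inl_ne_inr h
    · obtain ⟨⟨signer, content⟩, hp, h⟩ := hsm
      obtain ⟨hsigner, hcontent⟩ := PSig.mk.inj h
      obtain rfl : (⟨signer, content⟩ : PSig n E.Content) = s :=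
        congrArg₂ PSig.mk hsigner (Sum.inr_injective hcontent)
      exact hp

theorem eba_unforgeable (r : ℕ) (hi : i ∈ B) (j : Fin n) (m : E.Msg)
    (hm : m ∈ α.ebaSent (ebaStart cfg + r) i j) (s : PSig n E.Content) (hs : s ∈ E.shares m)
    (hsB : s.signer ∉ B) :
    ∃ r' ≤ r, ∃ j', ∃ m' ∈ α.ebaSent (ebaStart cfg + r') s.signer j', s ∈ E.shares m' := by
  obtain ⟨m₀, hm₀, hmm₀⟩ := List.mem_filterMap.1 hm
  obtain rfl := Sum.getRight?_eq_some_iff.1 hmm₀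
  obtain ⟨r', hr', j', m', hm', hsm'⟩ := α.unforgeable _ i hi j _ hm₀ ⟨s.signer, Sum.inr s.content⟩
    ⟨s, hs, rfl⟩ hsB
  obtain ⟨hle, hshare⟩ := α.exists_mem_ebaSent_of_mem_shares hsB hm' hsm'
  exact ⟨r' - ebaStart cfg, by omega, j', by rwa [Nat.add_sub_cancel' hle]⟩

/-- The execution of EBA within an execution of STRONG. Correct processes have acquired a pair by
round `ebaStart cfg`; the defaults of `Option.getD` concern faulty processes only. -/
noncomputable def eba : Execution E B where
  input i := (α.localState (ebaStart cfg) i).cert.getD (⊥, .negative [])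
  state r i := (α.state (ebaStart cfg + r) i).2.getD
    (E.start i ((α.localState (ebaStart cfg) i).cert.getD (⊥, .negative [])))
  sent r := α.ebaSent (ebaStart cfg + r)
  state_zero i hi := by
    obtain ⟨c, hc⟩ := Option.ne_none_iff_exists'.1 (α.cert_ebaStart_ne_none hi)
    rw [add_zero, α.eba_state_ebaStart hi, hc]
    rfl
  sent_correct r i hi j := by
    obtain ⟨e, he⟩ := Option.ne_none_iff_exists'.1 (α.eba_state_ne_none hi r)
    rw [α.ebaSent_eq hi (Nat.le_add_right _ _), he]
    rfl
  state_succ r i hi := by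
    obtain ⟨e, he⟩ := Option.ne_none_iff_exists'.1 (α.eba_state_ne_none hi r)
    rw [← add_assoc, α.eba_state_succ hi (Nat.le_add_right _ _), he]
    rfl
  unforgeable r _ hi j m hm s hs hsB := α.eba_unforgeable r hi j m hm s hs hsB

theorem valid_eba_input (hn : 2 * cfg.t + 1 + cfg.tO ≤ n) (hn3 : n < 3 * (cfg.t + 1))
    (hB : B.card ≤ cfg.t) (h : B.card ≤ cfg.tO ∨ cfg.relay = true) (hi : i ∉ B) :
    Valid cfg.t (α.eba.input i) := by
  obtain ⟨c, hc⟩ := Option.ne_none_iff_exists'.1 (α.cert_ebaStart_ne_none hi)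
  have hinput : α.eba.input i = c := by simp only [eba, hc, Option.getD_some]
  rw [hinput]
  exact α.agreementPhase.valid_cert_four (fun j hj => α.sound (by omega) hn3 hj le_rfl) (by omega)
    (h.imp_left (α.certified_bucketLength hn hn3)) hi c hc

theorem wordsBefore_ebaStart_add (R : ℕ) :
    α.wordsBefore (ebaStart cfg + R) =
      ∑ r ∈ Finset.range (ebaStart cfg), α.localWords r + α.eba.wordsBefore R := by
  rw [Execution.wordsBefore, Finset.sum_range_add]
  congr 1 <;> refine Finset.sum_congr rfl fun r hr => Finset.sum_congr rfl fun i hi =>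
    Finset.sum_congr rfl fun j _ => ?_
  · have hr : r < ebaStart cfg := Finset.mem_range.1 hr
    have hi : i ∉ B := Finset.mem_compl.1 hi
    rw [α.sent_eq_map_inl hi hr, α.localSent_eq hi hr]
    exact congrArg List.sum List.map_map
  · have hr : ebaStart cfg ≤ ebaStart cfg + r := Nat.le_add_right _ _
    have hi : i ∉ B := Finset.mem_compl.1 hi
    have hsent : α.eba.sent r i j = α.ebaSent (ebaStart cfg + r) i j := rfl
    rw [α.sent_eq_map_inr hi hr, hsent, α.ebaSent_eq hi hr]
    exact congrArg List.sum List.map_map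

theorem eba_wordsBefore_le (hn : 2 * cfg.t + 1 + cfg.tO ≤ n) (hn3 : n < 3 * (cfg.t + 1))
    {K D : ℕ} (hB : B.card ≤ cfg.t) (hD : cfg.tO < B.card → n ≤ D * (B.card + 1))
    (hE : E.wordComplexity (Valid cfg.t) B.card ≤ (K * n * (B.card + 1) : ℕ))
    (hE' : cfg.relay = true ∨ E.wordComplexity (fun _ => True) B.card ≤ (K * n ^ 2 : ℕ))
    (R : ℕ) : α.eba.wordsBefore R ≤ K * n * ((D + 1) * (B.card + 1)) := by
  by_cases h : B.card ≤ cfg.tO ∨ cfg.relay = true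
  · have hle : α.eba.wordsBefore R ≤ K * n * (B.card + 1) :=
      Nat.cast_le.1 <| (α.eba.wordsBefore_le_wordComplexity
        (fun i hi => α.valid_eba_input hn hn3 hB h hi) R).trans hE
    exact hle.trans (Nat.mul_le_mul_left _ (Nat.le_mul_of_pos_left _ D.succ_pos))
  · obtain ⟨hmany, hrelay⟩ := not_or.1 h
    have hle : α.eba.wordsBefore R ≤ K * n ^ 2 :=
      Nat.cast_le.1 <| (α.eba.wordsBefore_le_wordComplexity (fun _ _ => trivial) R).trans
        (hE'.resolve_left hrelay)
    rw [pow_two, ← mul_assoc] at hle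
    exact hle.trans <| Nat.mul_le_mul_left _ <|
      (hD (not_le.1 hmany)).trans (Nat.mul_le_mul_right _ D.le_succ)

end StrongExecution

theorem strong_wordComplexity_le {n : ℕ} {V : Type u} [LinearOrder V] [BoundedOrder V]
    {cfg : Config V} {E : EBAProtocol n V} (hn : 2 * cfg.t + 1 + cfg.tO ≤ n)
    (hn3 : n < 3 * (cfg.t + 1)) {K D f : ℕ} (hf : f ≤ cfg.t)
    (hD : cfg.tO < f → n ≤ D * (f + 1))
    (hE : E.wordComplexity (Valid cfg.t) f ≤ (K * n * (f + 1) : ℕ))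
    (hE' : cfg.relay = true ∨ E.wordComplexity (fun _ => True) f ≤ (K * n ^ 2 : ℕ)) :
    (strong cfg E).wordComplexity (fun _ => True) f ≤
      (((18 + 4 * (D + 1)) * maxMsgWords + K * (D + 1)) * n * (f + 1) : ℕ) := by
  refine iSup₂_le fun B hBf => iSup₂_le fun (α : StrongExecution cfg E B) _ => iSup_le fun R => ?_
  subst hBf
  refine Nat.cast_le.2 ?_
  calc α.wordsBefore R ≤ α.wordsBefore (ebaStart cfg + R) :=
        α.wordsBefore_mono (Nat.le_add_left _ _)
    _ = ∑ r ∈ Finset.range (ebaStart cfg), α.localWords r + α.eba.wordsBefore R :=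
        α.wordsBefore_ebaStart_add R
    _ ≤ (18 + 4 * (D + 1)) * maxMsgWords * n * (B.card + 1) +
          K * n * ((D + 1) * (B.card + 1)) :=
        Nat.add_le_add (α.sum_localWords_le hn hn3 hD)
          (α.eba_wordsBefore_le hn hn3 hf hD hE hE' R)
    _ = ((18 + 4 * (D + 1)) * maxMsgWords + K * (D + 1)) * n * (B.card + 1) := by ring

theorem numProcs_lt {c : ℝ} (hc1 : c ≤ 1) (t : ℕ) : numProcs c t < 3 * (t + 1) := by
  have : ⌈c * t⌉₊ ≤ t := Nat.ceil_le.2 (mul_le_of_le_one_left t.cast_nonneg hc1)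
  unfold numProcs
  omega

theorem le_numProcs (c : ℝ) (t : ℕ) : 2 * t + 1 + optThreshold c t ≤ numProcs c t :=
  Nat.add_le_add_left (Nat.floor_le_ceil _) _

theorem le_ceil_inv_mul_of_optThreshold_lt {c : ℝ} (hc0 : 0 < c) {t f : ℕ}
    (h : optThreshold c t < f) : t ≤ ⌈c⁻¹⌉₊ * f := by
  have hct : c * t < f := (Nat.floor_lt (by positivity)).1 h
  have : (t : ℝ) ≤ ⌈c⁻¹⌉₊ * f :=
    calc (t : ℝ) = c⁻¹ * (c * t) := by field_simp
      _ ≤ ⌈c⁻¹⌉₊ * f := by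
        gcongr
        exact Nat.le_ceil _
  exact_mod_cast this

theorem numProcs_le_of_optThreshold_lt {c : ℝ} (hc0 : 0 < c) (hc1 : c ≤ 1) {t f : ℕ}
    (h : optThreshold c t < f) : numProcs c t ≤ (3 * ⌈c⁻¹⌉₊ + 3) * (f + 1) := by
  have ht := le_ceil_inv_mul_of_optThreshold_lt hc0 h
  calc numProcs c t ≤ 3 * (t + 1) := (numProcs_lt hc1 t).le
    _ ≤ (3 * ⌈c⁻¹⌉₊ + 3) * (f + 1) := by linarith [Nat.zero_le f, Nat.zero_le ⌈c⁻¹⌉₊]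

end SBA

theorem mainTheorem2 (c : ℝ) (hc0 : 0 < c) (hc1 : c ≤ 1) (K : ℕ) :
    ∃ C : ℕ, ∀ (t : ℕ) (V : Type*) [LinearOrder V] [BoundedOrder V] (defaultValue : V)
      (relay : Bool) (E : SBA.EBAProtocol (SBA.numProcs c t) V),
      (∀ f ≤ t, E.wordComplexity (SBA.Valid t) f ≤ (K * SBA.numProcs c t * (f + 1) : ℕ)) →
      (relay = true ∨
        ∀ f ≤ t, E.wordComplexity (fun _ => True) f ≤ (K * SBA.numProcs c t ^ 2 : ℕ)) →
      ∀ f ≤ t,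
        (SBA.strong ⟨t, SBA.optThreshold c t, defaultValue, relay⟩ E).wordComplexity
          (fun _ => True) f ≤ (C * SBA.numProcs c t * (f + 1) : ℕ) :=
  ⟨_, fun t _ _ _ defaultValue relay _ hE hE' f hf =>
    SBA.strong_wordComplexity_le (cfg := ⟨t, SBA.optThreshold c t, defaultValue, relay⟩)
      (SBA.le_numProcs c t) (SBA.numProcs_lt hc1 t) hf
      (SBA.numProcs_le_of_optThreshold_lt hc0 hc1) (hE f hf) (hE'.imp_right fun h => h f hf)⟩
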